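/- Let $n\ge 1$ be an integer, let $\mathbb B_n$ be the open unit ball of $\mathbb C^n$, let $\langle z,w\rangle=\sum_{j} z_j\overline{w_j}$, $|z|=\sqrt{\langle z,z\rangle}$, and let $\lambda_n$ be Lebesgue measure on $\mathbb C^n$. For real $a>-1$ and $b>-n$ put $$d\mu_{a,b}(z)=\frac{(n-1)!}{\pi^n\beta(a+1,b+n)}\,|z|^{2b}(1-|z|^2)^a\,d\lambda_n(z)\ \text{ on }\mathbb B_n,\qquad \beta(s,t)=\frac{\Gamma(s)\Gamma(t)}{\Gamma(s+t)},$$ $$Q_{a,b}(\xi)={}_2F_1(b,-(a+1);\,b+n;\,\xi)\quad(|\xi|\le 1),\qquad \mathcal K_{a,b}(\xi)={}_2F_1(n,\,a+b+n+1;\,b+n;\,\xi)\quad(|\xi|<1).$$ Theorem 2.5. Let $a,c>-1$ and $b,d>-n$ be real, and assume that $Q_{a,b}$ has no zero in the closed unit disk $\overline{\mathbb D}$. Define, for functions $f$ on $\mathbb B_n$ and $z\in\mathbb B_n$, $$Tf(z)=\int_{\mathbb B_n} f(w)\,\mathcal K_{a,b}(\langle z,w\rangle)\,d\mu_{a,b}(w),$$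 $$Sf(z)=\int_{\mathbb B_n}\frac{f(w)\,|Q_{a,b}(\langle z,w\rangle)|}{|1-\langle z,w\rangle|^{a+n+1}}(1-|w|^2)^{a-c}|w|^{2b-2d}\,d\mu_{c,d}(w).$$ Then $$Tf(z)=\frac{\beta(c+1,d+n)}{\beta(a+1,b+n)}\int_{\mathbb B_n}\frac{f(w)\,Q_{a,b}(\langle z,w\rangle)}{(1-\langle z,w\rangle)^{a+n+1}}(1-|w|^2)^{a-c}|w|^{2b-2d}\,d\mu_{c,d}(w)$$ (principal branch of the power), and for every real $p$ with $1\le p<\infty$ the following assertions are equivalent: 1. $T$ is bounded on $L^p(\mathbb B_n,d\mu_{c,d})$; 2. $S$ is bounded on $L^p(\mathbb B_n,d\mu_{c,d})$; 3. $c+1<p(a+1)$, and $d+n<p(b+n)$ if $p>1$, respectively $d\le b$ if $p=1$. Here an integral operator is called bounded on $L^p(\mathbb B_n,d\mu_{c,d})$ if there is a constant $C$ such that, for every $f$ in this space, the defining integral converges absolutely for almost every $z$ and defines a function in the space whose norm is at most $C$ times that of $f$. -/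

import Mathlib

open MeasureTheory
open scoped NNReal ENNReal

noncomputable section

namespace BergmanType

/-- Complex Euclidean space `ℂⁿ`, with its Euclidean norm. Its `volume` is the Lebesgue measure
(normalized to be `1` on unit cubes of `ℝ²ⁿ`). -/
abbrev Cn (n : ℕ) : Type := EuclideanSpace ℂ (Fin n)

/-- The Hermitian product `⟨z, w⟩ = ∑ⱼ zⱼ * conj wⱼ`, linear in the first variable. -/
def herm {n : ℕ} (z w : Cn n) : ℂ := ∑ j, z j * (starRingEnd ℂ) (w j)

/-- The measure `dμ_{a,b}(z) = (n-1)! / (πⁿ β(a+1, b+n)) |z|^{2b} (1-|z|²)^a dλₙ(z)` on the open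
unit ball, extended by zero to `ℂⁿ`. Here `β(s,t) = Γ(s) Γ(t) / Γ(s+t)`. -/
def mu (n : ℕ) (a b : ℝ) : Measure (Cn n) :=
  (volume.restrict (Metric.ball (0 : Cn n) 1)).withDensity fun z =>
    ENNReal.ofReal (((n - 1).factorial : ℝ) /
      (Real.pi ^ n * ProbabilityTheory.beta (a + 1) (b + n)) *
        (‖z‖ ^ (2 * b) * (1 - ‖z‖ ^ 2) ^ a))

/-- `Q_{a,b}(ξ) = ₂F₁(b, -(a+1); b+n; ξ)`. -/
def Q (n : ℕ) (a b : ℝ) (ξ : ℂ) : ℂ :=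
  ordinaryHypergeometric b (-(a + 1)) (b + n) ξ

/-- `𝒦_{a,b}(ξ) = ₂F₁(n, a+b+n+1; b+n; ξ)`; the reproducing kernel of the modified Bergman space
is `𝒦_{a,b}(⟨z, w⟩)`. -/
def K (n : ℕ) (a b : ℝ) (ξ : ℂ) : ℂ :=
  ordinaryHypergeometric (n : ℝ) (a + b + n + 1) (b + n) ξ

/-- The integral operator with kernel `k` with respect to the measure `ν`. -/
def integralOp {X : Type*} [MeasurableSpace X] (k : X → X → ℂ) (ν : Measure X)
    (f : X → ℂ) (z : X) : ℂ :=
  ∫ w, f w * k z w ∂ν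

/-- The integral operator with kernel `k` with respect to `ν` is (well defined and) bounded on
`L^p(μ)`: for every `f` in `L^p(μ)` the integral converges absolutely for almost every `z`, the
resulting function is in `L^p(μ)`, and its norm is at most a constant times that of `f`. -/
def IsBoundedOnLp {X : Type*} [MeasurableSpace X] (k : X → X → ℂ) (ν μ : Measure X)
    (p : ℝ≥0∞) : Prop :=
  ∃ C : ℝ≥0, ∀ f : X → ℂ, MemLp f p μ →
    (∀ᵐ z ∂μ, Integrable (fun w => f w * k z w) ν) ∧
      MemLp (integralOp k ν f) p μ ∧
      eLpNorm (integralOp k ν f) p μ ≤ C * eLpNorm f p μ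

/-- The kernel of `T` with respect to `μ_{a,b}`. -/
def kerT (n : ℕ) (a b : ℝ) (z w : Cn n) : ℂ := K n a b (herm z w)

/-- The kernel of `S` with respect to `μ_{c,d}`. -/
def kerS (n : ℕ) (a b c d : ℝ) (z w : Cn n) : ℂ :=
  ((‖Q n a b (herm z w)‖ / ‖1 - herm z w‖ ^ (a + n + 1) *
    ((1 - ‖w‖ ^ 2) ^ (a - c) * ‖w‖ ^ (2 * b - 2 * d)) : ℝ) : ℂ)

/-- `Tf(z) = ∫ f(w) 𝒦_{a,b}(⟨z,w⟩) dμ_{a,b}(w)`. -/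
def T (n : ℕ) (a b : ℝ) (f : Cn n → ℂ) (z : Cn n) : ℂ :=
  integralOp (kerT n a b) (mu n a b) f z

end BergmanType

end

/-! Euler's transformation gives 𝒦(ξ) = Q(ξ) (1 - ξ)^{-(a+n+1)}, and Q is continuous on the closed
disk because its Taylor coefficients are O(k^{-(a+n+2)}). Writing μ_{a,b} as a density against
μ_{c,d} yields the integral form of T (`T_eq`), and shows that the kernel of S is, up to a constant,
the modulus of that of T. Hence S controls T (`kerT_bounded_of_kerS_bounded`). The way back from T
to S is not a comparison of kernels; it goes through the exponent conditions.

The analytic core is the Forelli-Rudin integral of |1 - ⟨z,w⟩|^{-(n+1+t+s)} against μ_{t,u}.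
Averaging over phases, Parseval on circles and the explicit moments of ⟨z,w⟩ turn it into a power
series in |z|² with coefficients comparable to (k+1)^{s-1} (`exists_lintegral_one_sub_herm_eq`). It
is thus O((1-|z|²)^{-s}) for s > 0 and unbounded for s = 0. The parameter u affects constants only.

Sufficiency: Q is bounded, so Schur's test with a function (1-|w|²)^{-α} |w|^{-2β} settles p > 1,
and the column integrals alone settle p = 1.

Necessity for p > 1: near z = 0 the kernel of T is close to 1, so integration against μ_{a,b} is a
bounded functional on L^p(μ_{c,d}). By duality the density of μ_{a,b} lies in L^q, which is the
convergence of a Beta integral. For p = 1, testing T on small balls bounds (1-|w|²)^{a-c}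
|w|^{2(b-d)} ∫ |𝒦(⟨z,w⟩)| dμ_{c,d}(z) uniformly in w. A lower bound for |Q| then gives c ≤ a and d ≤
b, and the divergence at s = 0 excludes c = a. -/

noncomputable section

namespace BergmanType

open Filter Topology

/-! ### Growth of binomial and hypergeometric coefficients -/

/-- The Taylor coefficient `(x)ₖ / k!` of `(1 - ξ)^(-x)`. -/
def risingCoeff (x : ℝ) (k : ℕ) : ℝ := (ascPochhammer ℝ k).eval x / k.factorial

lemma risingCoeff_zero (x : ℝ) : risingCoeff x 0 = 1 := by simp [risingCoeff]

lemma risingCoeff_succ (x : ℝ) (k : ℕ) :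
    (k + 1) * risingCoeff x (k + 1) = (x + k) * risingCoeff x k := by
  have h : (k.factorial : ℝ) ≠ 0 := by positivity
  simp only [risingCoeff, ascPochhammer_succ_eval, Nat.factorial_succ]
  push_cast
  field_simp

lemma risingCoeff_pos {x : ℝ} (hx : 0 < x) (k : ℕ) : 0 < risingCoeff x k :=
  div_pos (ascPochhammer_pos k x hx) (by positivity)

lemma ascPochhammer_eval_succ_left (x : ℝ) (k : ℕ) :
    (ascPochhammer ℝ (k + 1)).eval x = x * (ascPochhammer ℝ k).eval (x + 1) := by
  induction k with
  | zero => simp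
  | succ k ih =>
    rw [ascPochhammer_succ_eval, ih, ascPochhammer_succ_eval]
    push_cast
    ring

lemma ascPochhammer_eval_eq_prod (x : ℝ) (k : ℕ) :
    (ascPochhammer ℝ k).eval x = ∏ j ∈ Finset.range k, (x + j) := by
  induction k with
  | zero => simp
  | succ k ih => rw [ascPochhammer_succ_eval, ih, Finset.prod_range_succ]

/-- This is Euler's limit formula for Γ. The index is shifted by one because `Real.GammaSeq x k` has
k + 1 factors in its denominator. -/
lemma tendsto_risingCoeff_div {x : ℝ} (hx : 0 < x) :
    Tendsto (fun k : ℕ => risingCoeff x k / ((k : ℝ) + 1) ^ (x - 1)) atTop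
      (𝓝 (Real.Gamma x)⁻¹) := by
  rw [← tendsto_add_atTop_iff_nat 1]
  have h1 := (Real.GammaSeq_tendsto_Gamma x).inv₀ (Real.Gamma_pos_of_pos hx).ne'
  have h2 : Tendsto (fun k : ℕ => ((k : ℝ) / (k + 2))) atTop (𝓝 1) := by
    exact_mod_cast tendsto_natCast_div_add_atTop (2 : ℝ)
  have h3 : Tendsto (fun k : ℕ => ((k : ℝ) / (k + 1))) atTop (𝓝 1) := by
    exact_mod_cast tendsto_natCast_div_add_atTop (1 : ℝ)
  have h4 := ((h2.rpow_const (p := x) (Or.inl one_ne_zero)).mul ((h3.div h2 one_ne_zero))).mul h1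
  simp only [Real.one_rpow, div_one, one_mul, Pi.div_apply] at h4
  refine h4.congr' ?_
  filter_upwards [eventually_gt_atTop 0] with k hk
  have hk' : (0 : ℝ) < k := by exact_mod_cast hk
  have hf : (k.factorial : ℝ) ≠ 0 := by positivity
  rw [Real.GammaSeq, ← ascPochhammer_eval_eq_prod, risingCoeff, Nat.factorial_succ,
    Real.div_rpow hk'.le (by positivity)]
  have h5 : ((↑(k + 1) : ℝ) + 1) ^ (x - 1) = ((k : ℝ) + 2) ^ x / (k + 2) := by
    rw [Real.rpow_sub (by positivity), Real.rpow_one]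
    push_cast
    ring_nf
  have h6 : ((k : ℝ) + 2) ^ x ≠ 0 := by positivity
  have h7 : (k : ℝ) ^ x ≠ 0 := by positivity
  have h8 := (ascPochhammer_pos (k + 1) x hx).ne'
  rw [h5]
  push_cast
  field_simp

/-- The normalized coefficients are positive with a positive limit, so both they and their inverses
are bounded. -/
lemma risingCoeff_bounds {x : ℝ} (hx : 0 < x) : ∃ c C : ℝ, 0 < c ∧ 0 < C ∧ ∀ k : ℕ,
    c * ((k : ℝ) + 1) ^ (x - 1) ≤ risingCoeff x k ∧
      risingCoeff x k ≤ C * ((k : ℝ) + 1) ^ (x - 1) := by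
  have hG := Real.Gamma_pos_of_pos hx
  have h1 := tendsto_risingCoeff_div hx
  have h2 := h1.inv₀ (inv_pos.2 hG).ne'
  obtain ⟨C, hC⟩ := h1.bddAbove_range
  obtain ⟨D, hD⟩ := h2.bddAbove_range
  have hpos : ∀ k : ℕ, (0 : ℝ) < ((k : ℝ) + 1) ^ (x - 1) := fun k => by positivity
  have hv : ∀ k : ℕ, 0 < risingCoeff x k / ((k : ℝ) + 1) ^ (x - 1) := fun k =>
    div_pos (risingCoeff_pos hx k) (hpos k)
  have hC' : ∀ k : ℕ, risingCoeff x k / ((k : ℝ) + 1) ^ (x - 1) ≤ C := fun k => hC ⟨k, rfl⟩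
  have hD' : ∀ k : ℕ, (risingCoeff x k / ((k : ℝ) + 1) ^ (x - 1))⁻¹ ≤ D := fun k => hD ⟨k, rfl⟩
  have hD0 : 0 < D := (inv_pos.2 (hv 0)).trans_le (hD' 0)
  refine ⟨D⁻¹, C, inv_pos.2 hD0, (hv 0).trans_le (hC' 0), fun k => ⟨?_, ?_⟩⟩
  · rw [← le_div_iff₀ (hpos k)]
    exact inv_le_of_inv_le₀ (hv k) (hD' k)
  · rw [← div_le_iff₀ (hpos k)]
    exact hC' k

/-- For x ≤ 0 the coefficients may vanish, so only an upper bound survives. It descends from the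
positive case through (x)_{k+1} = x (x+1)_k, by induction on the number of unit shifts that make x
positive. -/
lemma abs_risingCoeff_le (x : ℝ) : ∃ C : ℝ, 0 < C ∧ ∀ k : ℕ,
    |risingCoeff x k| ≤ C * ((k : ℝ) + 1) ^ (x - 1) := by
  have key : ∀ m : ℕ, ∀ x : ℝ, 0 < x + m → ∃ C : ℝ, 0 < C ∧ ∀ k : ℕ,
      |risingCoeff x k| ≤ C * ((k : ℝ) + 1) ^ (x - 1) := by
    intro m
    induction m with
    | zero =>
      intro x hx
      obtain ⟨_, C, _, hC, h⟩ := risingCoeff_bounds (x := x) (by simpa using hx)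
      refine ⟨C, hC, fun k => ?_⟩
      rw [abs_of_pos (risingCoeff_pos (by simpa using hx) k)]
      exact (h k).2
    | succ m ih =>
      intro x hx
      obtain ⟨C, hC, h⟩ := ih (x + 1) (by push_cast at hx; linarith)
      -- The 1 covers k = 0; the factor 2^|x-1| pays for replacing k + 1 by k + 2.
      refine ⟨max 1 (|x| * C * 2 ^ |x - 1|), by positivity, fun k => ?_⟩
      rcases k with _ | k
      · simp [risingCoeff_zero]
      · have e : risingCoeff x (k + 1) = x * risingCoeff (x + 1) k / (k + 1) := by
          have hf : (k.factorial : ℝ) ≠ 0 := by positivity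
          simp only [risingCoeff, ascPochhammer_eval_succ_left, Nat.factorial_succ]
          push_cast
          field_simp
        have hk : (0 : ℝ) < (k : ℝ) + 1 := by positivity
        have h2 : ((k : ℝ) + 1) ^ (x - 1) ≤
            2 ^ |x - 1| * ((↑(k + 1) : ℝ) + 1) ^ (x - 1) := by
          have hle : ((k : ℝ) + 1) / ((↑(k + 1) : ℝ) + 1) ≤ 1 := by
            rw [div_le_one (by positivity)]
            push_cast
            linarith
          have hge : (2 : ℝ)⁻¹ ≤ ((k : ℝ) + 1) / ((↑(k + 1) : ℝ) + 1) := by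
            rw [le_div_iff₀ (by positivity)]
            push_cast
            linarith
          rw [← div_le_iff₀ (by positivity), ← Real.div_rpow hk.le (by positivity)]
          calc (((k : ℝ) + 1) / ((↑(k + 1) : ℝ) + 1)) ^ (x - 1)
              ≤ (((k : ℝ) + 1) / ((↑(k + 1) : ℝ) + 1)) ^ (-|x - 1|) :=
                Real.rpow_le_rpow_of_exponent_ge (by positivity) hle (neg_abs_le _)
            _ ≤ ((2 : ℝ)⁻¹) ^ (-|x - 1|) :=
                Real.rpow_le_rpow_of_nonpos (by positivity) hge (by simp)
            _ = 2 ^ |x - 1| := by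
                rw [Real.inv_rpow (by norm_num), Real.rpow_neg (by norm_num), inv_inv]
        calc |risingCoeff x (k + 1)| = |x| * |risingCoeff (x + 1) k| / (k + 1) := by
              rw [e, abs_div, abs_mul, abs_of_pos hk]
          _ ≤ |x| * (C * ((k : ℝ) + 1) ^ (x + 1 - 1)) / (k + 1) := by
              gcongr
              exact h k
          _ = |x| * C * ((k : ℝ) + 1) ^ (x - 1) := by
              rw [add_sub_cancel_right, Real.rpow_sub hk, Real.rpow_one]
              field_simp
          _ ≤ |x| * C * (2 ^ |x - 1| * ((↑(k + 1) : ℝ) + 1) ^ (x - 1)) := by gcongr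
          _ = (|x| * C * 2 ^ |x - 1|) * ((↑(k + 1) : ℝ) + 1) ^ (x - 1) := by ring
          _ ≤ _ := by
              gcongr
              exact le_max_right _ _
  obtain ⟨m, hm⟩ := exists_nat_gt (-x)
  exact key m x (by linarith)

/-- The Taylor coefficients of `₂F₁(A, B; C; ξ)`. -/
def hypCoeff (A B C : ℝ) (k : ℕ) : ℝ :=
  (k.factorial : ℝ)⁻¹ * (ascPochhammer ℝ k).eval A * (ascPochhammer ℝ k).eval B *
    ((ascPochhammer ℝ k).eval C)⁻¹

lemma hypCoeff_zero (A B C : ℝ) : hypCoeff A B C 0 = 1 := by simp [hypCoeff]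

lemma hypCoeff_succ (A B : ℝ) {C : ℝ} (hC : 0 < C) (k : ℕ) :
    (k + 1) * (C + k) * hypCoeff A B C (k + 1) = (A + k) * (B + k) * hypCoeff A B C k := by
  have h : (k.factorial : ℝ) ≠ 0 := by positivity
  have h1 := (ascPochhammer_pos k C hC).ne'
  have h2 : C + k ≠ 0 := by positivity
  simp only [hypCoeff, ascPochhammer_succ_eval, Nat.factorial_succ]
  push_cast
  field_simp

lemma ordinaryHypergeometric_eq_tsum_hypCoeff (A B C : ℝ) (ξ : ℂ) :
    ordinaryHypergeometric A B C ξ = ∑' k, (hypCoeff A B C k : ℂ) * ξ ^ k := by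
  rw [ordinaryHypergeometric_eq_tsum]
  simp only [hypCoeff, Complex.real_smul]

/-- The coefficient is a quotient of rising coefficients, with exponent (A-1) + (B-1) - (C-1). -/
lemma abs_hypCoeff_le (A B : ℝ) {C : ℝ} (hC : 0 < C) : ∃ M : ℝ, 0 < M ∧ ∀ k : ℕ,
    |hypCoeff A B C k| ≤ M * ((k : ℝ) + 1) ^ (A + B - C - 1) := by
  obtain ⟨MA, hMA, hA⟩ := abs_risingCoeff_le A
  obtain ⟨MB, hMB, hB⟩ := abs_risingCoeff_le B
  obtain ⟨c, _, hc, _, h⟩ := risingCoeff_bounds hC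
  refine ⟨MA * MB / c, by positivity, fun k => ?_⟩
  have hf : (k.factorial : ℝ) ≠ 0 := by positivity
  have h1 := (ascPochhammer_pos k C hC).ne'
  have e : hypCoeff A B C k = risingCoeff A k * risingCoeff B k / risingCoeff C k := by
    simp only [hypCoeff, risingCoeff]
    field_simp
  have hk : (0 : ℝ) < (k : ℝ) + 1 := by positivity
  rw [e, abs_div, abs_mul, abs_of_pos (risingCoeff_pos hC k)]
  calc |risingCoeff A k| * |risingCoeff B k| / risingCoeff C k
      ≤ (MA * ((k : ℝ) + 1) ^ (A - 1)) * (MB * ((k : ℝ) + 1) ^ (B - 1)) /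
        (c * ((k : ℝ) + 1) ^ (C - 1)) := by
        gcongr
        · exact hA k
        · exact hB k
        · exact (h k).1
    _ = MA * MB / c * (((k : ℝ) + 1) ^ (A - 1) * ((k : ℝ) + 1) ^ (B - 1) /
        ((k : ℝ) + 1) ^ (C - 1)) := by ring
    _ = _ := by
        rw [← Real.rpow_add hk, ← Real.rpow_sub hk]
        ring_nf

lemma summable_norm_mul_pow_of_abs_le {u : ℕ → ℝ} {M e : ℝ}
    (h : ∀ k : ℕ, |u k| ≤ M * ((k : ℝ) + 1) ^ e) {ξ : ℂ} (hξ : ‖ξ‖ < 1) :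
    Summable fun k => ‖(u k : ℂ) * ξ ^ k‖ := by
  have hM : 0 ≤ M := by simpa using (abs_nonneg _).trans (h 0)
  obtain ⟨m, hm⟩ := exists_nat_ge e
  have s0 : Summable fun k : ℕ => ((k + 1 : ℕ) : ℝ) ^ m * ‖ξ‖ ^ k := by
    by_cases h0 : ‖ξ‖ = 0
    · refine summable_of_ne_finset_zero (s := {0}) fun k hk => ?_
      simp only [Finset.mem_singleton] at hk
      simp [h0, hk]
    · have := ((summable_nat_add_iff 1).2 (summable_pow_mul_geometric_of_norm_lt_one (R := ℝ) m
        (r := ‖ξ‖) (by simpa using hξ))).mul_right (‖ξ‖⁻¹)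
      refine this.congr fun k => ?_
      rw [pow_succ]
      field_simp
  refine Summable.of_nonneg_of_le (fun k => norm_nonneg _) (fun k => ?_) (s0.mul_left M)
  rw [norm_mul, norm_pow, Complex.norm_real, Real.norm_eq_abs, ← mul_assoc]
  gcongr
  refine (h k).trans ?_
  gcongr
  rw [← Real.rpow_natCast]
  push_cast
  exact Real.rpow_le_rpow_of_exponent_le (by linarith [(Nat.cast_nonneg k : (0 : ℝ) ≤ k)]) hm

/-! ### Binomial series and Euler's transformation -/

lemma risingCoeff_eq_choose (x : ℝ) (k : ℕ) :
    (risingCoeff x k : ℂ) = Ring.choose ((x : ℂ) + k - 1) k := by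
  have h1 := Ring.factorial_nsmul_multichoose_eq_ascPochhammer x k
  rw [Ring.multichoose_eq] at h1
  have h2 : Ring.choose ((x : ℂ) + k - 1) k = ((Ring.choose (x + k - 1) k : ℝ) : ℂ) := by
    rw [Complex.ofReal_choose]
    push_cast
    rfl
  rw [h2, risingCoeff]
  congr 1
  rw [Polynomial.ascPochhammer_smeval_eq_eval] at h1
  rw [← h1, nsmul_eq_mul]
  field_simp

lemma hasSum_one_sub_cpow_neg (x : ℝ) {ξ : ℂ} (hξ : ‖ξ‖ < 1) :
    HasSum (fun k => (risingCoeff x k : ℂ) * ξ ^ k) (1 / (1 - ξ) ^ (x : ℂ)) := by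
  have h := (Complex.one_div_one_sub_cpow_hasFPowerSeriesOnBall_zero (x : ℂ)).hasSum (y := ξ)
    (by rwa [Metric.mem_eball, edist_zero_right, ← ofReal_norm, ENNReal.ofReal_lt_one])
  simp only [FormalMultilinearSeries.ofScalars_apply_eq, zero_add, smul_eq_mul] at h
  simpa only [risingCoeff_eq_choose] using h

/-- Coefficient form of Euler's transformation, by creative telescoping: the sum is shown to satisfy
the first-order recurrence `hypCoeff_succ`. -/
lemma sum_risingCoeff_mul_hypCoeff (A B : ℝ) {C : ℝ} (hC : 0 < C) (k : ℕ) :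
    ∑ j ∈ Finset.range (k + 1), risingCoeff (A + B - C) (k - j) * hypCoeff (C - A) (C - B) C j =
      hypCoeff A B C k := by
  set R := risingCoeff (A + B - C) with hR
  set H := hypCoeff (C - A) (C - B) C with hH
  induction k with
  | zero => simp [hR, hH, risingCoeff_zero, hypCoeff_zero]
  | succ k ih =>
    -- Telescoping certificate. The factor j makes G 0 vanish, and -G (k+1) is (k+1)(C+k) times the
    -- term j = k + 1 absent from the sum over `range (k + 1)`.
    obtain ⟨G, hG⟩ : ∃ G : ℕ → ℝ,
        G = fun j : ℕ => -((j : ℝ) * (C + j - 1) * (R (k + 1 - j) * H j)) := ⟨_, rfl⟩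
    have step : ∀ j ∈ Finset.range (k + 1),
        (k + 1) * (C + k) * (R (k + 1 - j) * H j) - (A + k) * (B + k) * (R (k - j) * H j) =
          G (j + 1) - G j := by
      intro j hj
      obtain ⟨m, rfl⟩ := Nat.exists_eq_add_of_le (Nat.lt_succ_iff.1 (Finset.mem_range.1 hj))
      have e1 : j + m + 1 - j = m + 1 := by omega
      have e2 : j + m - j = m := by omega
      have e3 : j + m + 1 - (j + 1) = m := by omega
      have hR' : (m + 1 : ℝ) * R (m + 1) = (A + B - C + m) * R m := risingCoeff_succ _ m
      have hH' : (j + 1 : ℝ) * (C + j) * H (j + 1) = (C - A + j) * (C - B + j) * H j :=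
        hypCoeff_succ _ _ hC j
      simp only [hG, e1, e2, e3]
      push_cast
      linear_combination H j * (C + 2 * j + m) * hR' + R m * hH'
    have hsum := Finset.sum_congr rfl step
    rw [Finset.sum_range_sub, Finset.sum_sub_distrib, ← Finset.mul_sum, ← Finset.mul_sum, ih]
      at hsum
    simp only [hG, Nat.sub_self] at hsum
    have hlast := hypCoeff_succ A B hC k
    have hne : ((k : ℝ) + 1) * (C + k) ≠ 0 := by positivity
    refine mul_left_cancel₀ hne ?_
    rw [Finset.sum_range_succ, hlast, Nat.sub_self]
    push_cast at hsum ⊢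
    linear_combination hsum

/-- **Euler's transformation** `₂F₁(A, B; C; ξ) = (1 - ξ)^(C-A-B) ₂F₁(C-A, C-B; C; ξ)`. -/
lemma ordinaryHypergeometric_euler (A B : ℝ) {C : ℝ} (hC : 0 < C) {ξ : ℂ} (hξ : ‖ξ‖ < 1) :
    ordinaryHypergeometric A B C ξ =
      ordinaryHypergeometric (C - A) (C - B) C ξ / (1 - ξ) ^ ((A + B - C : ℝ) : ℂ) := by
  obtain ⟨M, _, hM⟩ := abs_risingCoeff_le (A + B - C)
  obtain ⟨N, _, hN⟩ := abs_hypCoeff_le (C - A) (C - B) hC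
  have key := tsum_mul_tsum_eq_tsum_sum_antidiagonal_of_summable_norm
    (summable_norm_mul_pow_of_abs_le hM hξ) (summable_norm_mul_pow_of_abs_le hN hξ)
  rw [(hasSum_one_sub_cpow_neg _ hξ).tsum_eq, ← ordinaryHypergeometric_eq_tsum_hypCoeff] at key
  rw [div_eq_mul_one_div, mul_comm, key, ordinaryHypergeometric_eq_tsum_hypCoeff]
  refine tsum_congr fun k => ?_
  rw [← sum_risingCoeff_mul_hypCoeff A B hC k, ← Finset.Nat.sum_antidiagonal_swap,
    Finset.Nat.sum_antidiagonal_eq_sum_range_succ_mk]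
  push_cast
  rw [Finset.sum_mul]
  refine Finset.sum_congr rfl fun j hj => ?_
  have : k - j + j = k := Nat.sub_add_cancel (Nat.lt_succ_iff.1 (Finset.mem_range.1 hj))
  simp only [Prod.swap_prod_mk]
  rw [show ξ ^ k = ξ ^ (k - j) * ξ ^ j by rw [← pow_add, this]]
  ring

/-! ### The kernel 𝒦 and the factor Q on the disk -/

section Kernel

variable {n : ℕ} {a b : ℝ}

/-- With A = n, B = a+b+n+1, C = b+n one has C - A = b, C - B = -(a+1) and A + B - C = a+n+1. -/
lemma K_eq_div (hb : -(n : ℝ) < b) {ξ : ℂ} (hξ : ‖ξ‖ < 1) :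
    K n a b ξ = Q n a b ξ / (1 - ξ) ^ ((a + n + 1 : ℝ) : ℂ) := by
  have h := ordinaryHypergeometric_euler (n : ℝ) (a + b + n + 1) (C := b + n) (by linarith) hξ
  rw [K, Q, h]
  congr 3 <;> ring

/-- The coefficients are O((k+1)^{-(a+n+2)}), and a + n + 2 > 1, so the series converges uniformly
up to the boundary circle. -/
lemma continuousOn_Q (ha : -1 < a) (hb : -(n : ℝ) < b) :
    ContinuousOn (Q n a b) (Metric.closedBall 0 1) := by
  obtain ⟨M, _, hM⟩ := abs_hypCoeff_le b (-(a + 1)) (C := b + n) (by linarith)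
  have e : Q n a b = fun ξ => ∑' k, (hypCoeff b (-(a + 1)) (b + n) k : ℂ) * ξ ^ k := by
    ext ξ
    exact ordinaryHypergeometric_eq_tsum_hypCoeff _ _ _ _
  rw [e]
  refine continuousOn_tsum (u := fun k : ℕ => M * ((k : ℝ) + 1) ^ (b + -(a + 1) - (b + n) - 1))
    (fun k => by fun_prop) ?_ fun k ξ hξ => ?_
  · refine Summable.mul_left _ ?_
    have h := (summable_nat_add_iff 1).2 (Real.summable_nat_rpow
      (p := b + -(a + 1) - (b + n) - 1).2 (by
        have : (0 : ℝ) ≤ n := Nat.cast_nonneg n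
        linarith))
    exact_mod_cast h
  · rw [norm_mul, norm_pow, Complex.norm_real, Real.norm_eq_abs]
    refine (mul_le_of_le_one_right (abs_nonneg _) (pow_le_one₀ (norm_nonneg _) ?_)).trans (hM k)
    simpa using hξ

lemma exists_norm_Q_le (ha : -1 < a) (hb : -(n : ℝ) < b) :
    ∃ M : ℝ, 0 < M ∧ ∀ ξ : ℂ, ‖ξ‖ ≤ 1 → ‖Q n a b ξ‖ ≤ M := by
  obtain ⟨M, hM⟩ := (isCompact_closedBall (0 : ℂ) 1).exists_bound_of_continuousOn
    (continuousOn_Q ha hb)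
  refine ⟨max M 1, by positivity, fun ξ hξ => (hM ξ (by simpa using hξ)).trans (le_max_left _ _)⟩

/-- Compactness turns the absence of zeros into a uniform lower bound; this serves the necessity
part at p = 1. -/
lemma exists_le_norm_Q (ha : -1 < a) (hb : -(n : ℝ) < b)
    (hQ : ∀ ξ : ℂ, ‖ξ‖ ≤ 1 → Q n a b ξ ≠ 0) :
    ∃ m : ℝ, 0 < m ∧ ∀ ξ : ℂ, ‖ξ‖ ≤ 1 → m ≤ ‖Q n a b ξ‖ := by
  obtain ⟨ξ₀, h₀, h⟩ := (isCompact_closedBall (0 : ℂ) 1).exists_isMinOn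
    ⟨0, by simp⟩ (continuousOn_Q ha hb).norm
  exact ⟨‖Q n a b ξ₀‖, norm_pos_iff.2 (hQ ξ₀ (by simpa using h₀)),
    fun ξ hξ => h (by simpa using hξ : ξ ∈ Metric.closedBall (0 : ℂ) 1)⟩

lemma norm_K (hb : -(n : ℝ) < b) {ξ : ℂ} (hξ : ‖ξ‖ < 1) :
    ‖K n a b ξ‖ = ‖Q n a b ξ‖ / ‖1 - ξ‖ ^ (a + n + 1) := by
  rw [K_eq_div hb hξ, norm_div, Complex.norm_cpow_real]

lemma continuousOn_K (ha : -1 < a) (hb : -(n : ℝ) < b) :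
    ContinuousOn (K n a b) (Metric.ball 0 1) := by
  have h : ContinuousOn (fun ξ : ℂ => Q n a b ξ / (1 - ξ) ^ ((a + n + 1 : ℝ) : ℂ))
      (Metric.ball 0 1) := by
    have hs : ∀ ξ ∈ Metric.ball (0 : ℂ) 1, 1 - ξ ∈ Complex.slitPlane := by
      intro ξ hξ
      left
      have := (Complex.abs_re_le_norm ξ).trans_lt (by simpa using hξ)
      simp only [Complex.sub_re, Complex.one_re]
      linarith [(abs_lt.1 this).2]
    refine ((continuousOn_Q ha hb).mono Metric.ball_subset_closedBall).div ?_ fun ξ hξ => ?_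
    · exact ContinuousOn.cpow (by fun_prop) continuousOn_const hs
    · rw [Complex.cpow_ne_zero_iff]
      exact Or.inl (Complex.slitPlane_ne_zero (hs ξ hξ))
  exact h.congr fun ξ hξ => K_eq_div hb (by simpa using hξ)

lemma K_zero : K n a b 0 = 1 := ordinaryHypergeometric_zero _ _ _

end Kernel

open Set

/-! ### Polar coordinates and coordinate moments -/

section Polar

variable {n : ℕ}

lemma finrank_Cn : Module.finrank ℝ (Cn n) = 2 * n := by
  rw [← Module.finrank_mul_finrank ℝ ℂ (Cn n), Complex.finrank_real_complex,
    finrank_euclideanSpace, Fintype.card_fin]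

/-- Here and below `i : Fin n` carries the information n ≥ 1, and later also singles out a
coordinate. -/
lemma lintegral_polar (i : Fin n) (F : Cn n → ℝ≥0∞) :
    ∫⁻ w, F w = ∫⁻ p : Metric.sphere (0 : Cn n) 1 × Ioi (0 : ℝ), F ((p.2 : ℝ) • (p.1 : Cn n))
      ∂((volume : Measure (Cn n)).toSphere.prod (Measure.volumeIoiPow (2 * n - 1))) := by
  have : Nontrivial (Cn n) := by
    have := i.pos
    apply Module.nontrivial_of_finrank_pos (R := ℝ)
    rw [finrank_Cn]
    omega
  have h := (volume : Measure (Cn n)).measurePreserving_homeomorphUnitSphereProd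
  rw [finrank_Cn] at h
  have h2 := h.symm (homeomorphUnitSphereProd (Cn n)).toMeasurableEquiv
  have h3 := h2.lintegral_comp_emb
    (homeomorphUnitSphereProd (Cn n)).toMeasurableEquiv.symm.measurableEmbedding
    (fun w : ({0}ᶜ : Set (Cn n)) => F w)
  rw [lintegral_subtype_comap (measurableSet_singleton _).compl, restrict_compl_singleton] at h3
  exact h3.symm

lemma lintegral_volumeIoiPow (m : ℕ) {h : ℝ → ℝ≥0∞} (hh : Measurable h) :
    ∫⁻ r : Ioi (0 : ℝ), h r ∂(Measure.volumeIoiPow m) =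
      ∫⁻ r in Ioi (0 : ℝ), ENNReal.ofReal (r ^ m) * h r := by
  rw [Measure.volumeIoiPow, lintegral_withDensity_eq_lintegral_mul _ (by fun_prop) (by fun_prop)]
  exact lintegral_subtype_comap measurableSet_Ioi (fun r : ℝ => ENNReal.ofReal (r ^ m) * h r)

/-- The substitution x = r² makes radial integrals against the measures μ_{a,b} into Beta integrals.
-/
lemma lintegral_Ioi_comp_sq {m : ℕ} (hm : 1 ≤ m) (g : ℝ → ℝ≥0∞) :
    ∫⁻ x in Ioi (0 : ℝ), ENNReal.ofReal (x ^ (m - 1)) * g x =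
      2 * ∫⁻ r in Ioi (0 : ℝ), ENNReal.ofReal (r ^ (2 * m - 1)) * g (r ^ 2) := by
  have himg : (fun r : ℝ => r ^ 2) '' Ioi 0 = Ioi 0 := by
    ext x
    constructor
    · rintro ⟨r, hr, rfl⟩
      exact pow_pos (mem_Ioi.1 hr) 2
    · intro hx
      exact ⟨√x, Real.sqrt_pos.2 hx, Real.sq_sqrt (le_of_lt hx)⟩
  have h := lintegral_image_eq_lintegral_abs_deriv_mul (s := Ioi (0 : ℝ)) (f := fun r => r ^ 2)
    (f' := fun r => 2 * r) measurableSet_Ioi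
    (fun r _ => by simpa using (hasDerivAt_pow 2 r).hasDerivWithinAt)
    (fun x hx y hy hxy => by
      exact (pow_left_inj₀ (le_of_lt hx) (le_of_lt hy) two_ne_zero).1 hxy)
    (fun x => ENNReal.ofReal (x ^ (m - 1)) * g x)
  rw [himg] at h
  rw [h, ← lintegral_const_mul' _ _ (by simp)]
  refine setLIntegral_congr_fun measurableSet_Ioi fun r hr => ?_
  have hr0 : (0 : ℝ) < r := hr
  have e : (2 : ℝ≥0∞) = ENNReal.ofReal 2 := by simp
  rw [← mul_assoc, ← mul_assoc, e, ← ENNReal.ofReal_mul (by positivity),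
    ← ENNReal.ofReal_mul (by positivity), abs_of_pos (by positivity)]
  congr 2
  obtain ⟨m, rfl⟩ := Nat.exists_eq_add_of_le hm
  have e1 : 1 + m - 1 = m := by omega
  have e2 : 2 * (1 + m) - 1 = 2 * m + 1 := by omega
  rw [e1, e2]
  ring

/-- The constant is half the spherical integral of |ζᵢ|^{2k}. Only its independence of g matters
here: a Gaussian g will reveal its value. -/
lemma exists_lintegral_coord_eq (i : Fin n) (k : ℕ) : ∃ c : ℝ≥0∞, ∀ g : ℝ → ℝ≥0∞, Measurable g →
    ∫⁻ w : Cn n, ENNReal.ofReal (‖w i‖ ^ (2 * k)) * g (‖w‖ ^ 2) =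
      c * ∫⁻ x in Ioi (0 : ℝ), ENNReal.ofReal (x ^ (n + k - 1)) * g x := by
  have hn : 1 ≤ n := i.pos
  refine ⟨(∫⁻ ζ : Metric.sphere (0 : Cn n) 1, ENNReal.ofReal (‖(ζ : Cn n) i‖ ^ (2 * k))
    ∂(volume : Measure (Cn n)).toSphere) * 2⁻¹, fun g hg => ?_⟩
  have hcoord : Measurable fun w : Cn n => w i := by fun_prop
  rw [lintegral_polar i]
  have e : ∀ p : Metric.sphere (0 : Cn n) 1 × Ioi (0 : ℝ),
      ENNReal.ofReal (‖((p.2 : ℝ) • (p.1 : Cn n)) i‖ ^ (2 * k)) *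
        g (‖(p.2 : ℝ) • (p.1 : Cn n)‖ ^ 2) =
      ENNReal.ofReal (‖(p.1 : Cn n) i‖ ^ (2 * k)) *
        (fun r : ℝ => ENNReal.ofReal (r ^ (2 * k)) * g (r ^ 2)) p.2 := by
    rintro ⟨ζ, r⟩
    have hr : (0 : ℝ) < r := r.2
    have hζ : ‖(ζ : Cn n)‖ = 1 := by simp
    simp only [PiLp.smul_apply, norm_smul, hζ, mul_one, Real.norm_eq_abs, sq_abs, mul_pow]
    rw [ENNReal.ofReal_mul (by positivity), abs_of_pos hr]
    ring
  rw [lintegral_congr e, lintegral_prod_mul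
    (f := fun ζ : Metric.sphere (0 : Cn n) 1 => ENNReal.ofReal (‖(ζ : Cn n) i‖ ^ (2 * k)))
    (g := fun r : Ioi (0 : ℝ) => (fun r : ℝ => ENNReal.ofReal (r ^ (2 * k)) * g (r ^ 2)) r)
    (by fun_prop) (by fun_prop),
    lintegral_volumeIoiPow _ (h := fun r : ℝ => ENNReal.ofReal (r ^ (2 * k)) * g (r ^ 2))
      (by fun_prop), lintegral_Ioi_comp_sq (by omega) g, mul_assoc, ← mul_assoc 2⁻¹,
    ENNReal.inv_mul_cancel two_ne_zero ENNReal.ofNat_ne_top, one_mul]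
  congr 1
  refine setLIntegral_congr_fun measurableSet_Ioi fun r hr => ?_
  have hr0 : (0 : ℝ) < r := hr
  rw [← mul_assoc, ← ENNReal.ofReal_mul (by positivity), ← pow_add]
  congr 4
  omega

/-- Both volumes are Haar measures, hence proportional. The factor need not be identified, since it
does not depend on k. -/
lemma exists_lintegral_comp_ofLp : ∃ c : ℝ≥0, 0 < c ∧ ∀ F : (Fin n → ℂ) → ℝ≥0∞, Measurable F →
    ∫⁻ w : Cn n, F w.ofLp = c * ∫⁻ v, F v := by
  have : ((volume : Measure (Cn n)).map (EuclideanSpace.equiv (Fin n) ℂ)).IsAddHaarMeasure :=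
    ContinuousLinearEquiv.isAddHaarMeasure_map _ _
  refine ⟨Measure.addHaarScalarFactor
    ((volume : Measure (Cn n)).map (EuclideanSpace.equiv (Fin n) ℂ)) volume,
    Measure.addHaarScalarFactor_pos_of_isAddHaarMeasure _ _, fun F hF => ?_⟩
  have h := Measure.isAddLeftInvariant_eq_smul
    ((volume : Measure (Cn n)).map (EuclideanSpace.equiv (Fin n) ℂ)) volume
  have h2 := lintegral_map (μ := (volume : Measure (Cn n)))
    (g := (EuclideanSpace.equiv (Fin n) ℂ)) hF
    (EuclideanSpace.equiv (Fin n) ℂ).continuous.measurable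
  rw [h, lintegral_smul_measure] at h2
  exact h2.symm

lemma integral_norm_pow_mul_exp (k : ℕ) :
    ∫ z : ℂ, ‖z‖ ^ (2 * k) * Real.exp (-‖z‖ ^ 2) = Real.pi * k.factorial := by
  have h := Complex.integral_rpow_mul_exp_neg_rpow (p := 2) (q := ((2 * k : ℕ) : ℝ)) (by norm_num)
    (by
      have : (0 : ℝ) ≤ ((2 * k : ℕ) : ℝ) := Nat.cast_nonneg _
      linarith)
  have e : (((2 * k : ℕ) : ℝ) + 2) / 2 = (k : ℝ) + 1 := by
    push_cast
    ring
  rw [e, Real.Gamma_nat_eq_factorial] at h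
  simp only [Real.rpow_natCast, Real.rpow_two] at h
  rw [h]
  ring

/-- The Gaussian factors over coordinates: the i-th contributes π k! and every other one π. -/
lemma exists_lintegral_coord_gaussian (i : Fin n) : ∃ c : ℝ, 0 < c ∧ ∀ k : ℕ,
    ∫⁻ w : Cn n, ENNReal.ofReal (‖w i‖ ^ (2 * k)) * ENNReal.ofReal (Real.exp (-‖w‖ ^ 2)) =
      ENNReal.ofReal (c * k.factorial) := by
  obtain ⟨c, hc, h⟩ := exists_lintegral_comp_ofLp (n := n)
  refine ⟨c * Real.pi ^ n, by positivity, fun k => ?_⟩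
  set f : Fin n → ℂ → ℝ := fun j z =>
    ‖z‖ ^ (2 * (if j = i then k else 0)) * Real.exp (-‖z‖ ^ 2) with hf
  have hint : ∀ j, ∫ z, f j z = Real.pi * ((if j = i then k else 0).factorial : ℕ) := fun j =>
    integral_norm_pow_mul_exp _
  have hfi : ∀ j, Integrable (f j) := fun j => by
    refine Integrable.of_integral_ne_zero ?_
    rw [hint j]
    positivity
  have hprod := integral_fintype_prod_volume_eq_prod f
  have hI : Integrable fun v : Fin n → ℂ => ∏ j, f j (v j) := Integrable.fintype_prod hfi
  have e : ∀ w : Cn n, ENNReal.ofReal (‖w i‖ ^ (2 * k)) * ENNReal.ofReal (Real.exp (-‖w‖ ^ 2)) =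
      (fun v : Fin n → ℂ => ENNReal.ofReal (∏ j, f j (v j))) w.ofLp := by
    intro w
    rw [← ENNReal.ofReal_mul (by positivity)]
    simp only [hf, Finset.prod_mul_distrib, ← Real.exp_sum]
    rw [EuclideanSpace.norm_sq_eq, Finset.sum_neg_distrib]
    congr 2
    rw [Finset.prod_eq_single i]
    · simp
    · intro j _ hj
      simp [hj]
    · simp
  have hfm : Measurable fun v : Fin n → ℂ => ENNReal.ofReal (∏ j, f j (v j)) := by
    simp only [hf]
    fun_prop
  rw [lintegral_congr e, h _ hfm, ← ofReal_integral_eq_lintegral_ofReal hI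
    (ae_of_all _ fun v => Finset.prod_nonneg fun j _ => by positivity), hprod,
    ← ENNReal.ofReal_coe_nnreal, ← ENNReal.ofReal_mul (by positivity)]
  congr 1
  simp only [hint, Finset.prod_mul_distrib, Finset.prod_const, Finset.card_univ, Fintype.card_fin]
  rw [Finset.prod_eq_single i]
  · simp
    ring
  · intro j _ hj
    simp [hj]
  · simp

lemma lintegral_Ioi_pow_mul_exp {m : ℕ} (hm : 1 ≤ m) :
    ∫⁻ x in Ioi (0 : ℝ), ENNReal.ofReal (x ^ (m - 1)) * ENNReal.ofReal (Real.exp (-x)) =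
      ENNReal.ofReal (Real.Gamma m) := by
  have hm0 : (0 : ℝ) < m := by exact_mod_cast hm
  rw [Real.Gamma_eq_integral hm0, ofReal_integral_eq_lintegral_ofReal
    (Real.GammaIntegral_convergent hm0)]
  · refine setLIntegral_congr_fun measurableSet_Ioi fun x hx => ?_
    have hx0 : (0 : ℝ) < x := hx
    rw [← ENNReal.ofReal_mul (by positivity), mul_comm, ← Real.rpow_natCast, Nat.cast_sub hm,
      Nat.cast_one]
  · filter_upwards [ae_restrict_mem measurableSet_Ioi] with x hx
    have hx0 : (0 : ℝ) < x := hx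
    positivity

/-- Integration in polar coordinates against `‖wᵢ‖ ^ (2k)` times a function of `‖w‖ ^ 2`. -/
lemma exists_lintegral_coord (i : Fin n) : ∃ c : ℝ, 0 < c ∧ ∀ (k : ℕ) (g : ℝ → ℝ≥0∞),
    Measurable g → ∫⁻ w : Cn n, ENNReal.ofReal (‖w i‖ ^ (2 * k)) * g (‖w‖ ^ 2) =
      ENNReal.ofReal (c * (k.factorial / Real.Gamma (n + k : ℕ))) *
        ∫⁻ x in Ioi (0 : ℝ), ENNReal.ofReal (x ^ (n + k - 1)) * g x := by
  obtain ⟨κ, hκ, h⟩ := exists_lintegral_coord_gaussian i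
  refine ⟨κ, hκ, fun k g hg => ?_⟩
  obtain ⟨c, hc⟩ := exists_lintegral_coord_eq i k
  have hn := i.pos
  have hΓ : 0 < Real.Gamma (n + k : ℕ) := Real.Gamma_pos_of_pos (by positivity)
  -- Testing with g(x) = e^{-x} evaluates the unknown constant as κ k! / Γ(n+k).
  have h1 := hc (fun x => ENNReal.ofReal (Real.exp (-x))) (by fun_prop)
  rw [h k, lintegral_Ioi_pow_mul_exp (by omega)] at h1
  rw [hc g hg]
  congr 1
  rw [← mul_div_assoc, ENNReal.ofReal_div_of_pos hΓ, h1,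
    ENNReal.mul_div_cancel_right (by simpa using hΓ) ENNReal.ofReal_ne_top]

end Polar

/-! ### The measures μ_{a,b} as radial densities -/

/-- The normalizing constant of `mu n a b`. -/
def muConst (n : ℕ) (a b : ℝ) : ℝ :=
  ((n - 1).factorial : ℝ) / (Real.pi ^ n * ProbabilityTheory.beta (a + 1) (b + n))

/-- The density of `mu n a b` up to a constant, as a function of `‖z‖ ^ 2`. -/
def radialWeight (a b : ℝ) : ℝ → ℝ≥0∞ :=
  (Iio 1).indicator fun x => ENNReal.ofReal (x ^ b * (1 - x) ^ a)

section Weight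

variable {n : ℕ} {a b : ℝ}

lemma muConst_pos (ha : -1 < a) (hb : -(n : ℝ) < b) : 0 < muConst n a b :=
  div_pos (by positivity) (mul_pos (by positivity)
    (ProbabilityTheory.beta_pos (by linarith) (by linarith)))

@[fun_prop]
lemma measurable_radialWeight : Measurable (radialWeight a b) :=
  Measurable.indicator (by fun_prop) measurableSet_Iio

lemma mu_eq (ha : -1 < a) (hb : -(n : ℝ) < b) : mu n a b =
    ENNReal.ofReal (muConst n a b) •
      (volume : Measure (Cn n)).withDensity fun w => radialWeight a b (‖w‖ ^ 2) := by
  rw [← withDensity_smul _ (by fun_prop), mu, ← withDensity_indicator Metric.isOpen_ball.measurableSet]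
  congr 1
  ext w
  have hball : w ∈ Metric.ball (0 : Cn n) 1 ↔ ‖w‖ ^ 2 ∈ Iio (1 : ℝ) := by
    rw [mem_ball_zero_iff, mem_Iio, sq_lt_one_iff₀ (norm_nonneg _)]
  rw [Pi.smul_apply, radialWeight, smul_eq_mul]
  by_cases hw : w ∈ Metric.ball (0 : Cn n) 1
  · rw [indicator_of_mem hw, indicator_of_mem (hball.1 hw),
      ← ENNReal.ofReal_mul (muConst_pos ha hb).le, Real.rpow_mul (norm_nonneg _), Real.rpow_two,
      muConst]
  · rw [indicator_of_notMem hw, indicator_of_notMem (mt hball.2 hw), mul_zero]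

lemma radialWeight_lt_top (x : ℝ) : radialWeight a b x < ∞ := by
  by_cases hx : x ∈ Iio (1 : ℝ)
  · rw [radialWeight, indicator_of_mem hx]
    exact ENNReal.ofReal_lt_top
  · rw [radialWeight, indicator_of_notMem hx]
    exact ENNReal.zero_lt_top

lemma lintegral_mu (ha : -1 < a) (hb : -(n : ℝ) < b) (F : Cn n → ℝ≥0∞) :
    ∫⁻ w, F w ∂(mu n a b) =
      ENNReal.ofReal (muConst n a b) * ∫⁻ w, radialWeight a b (‖w‖ ^ 2) * F w := by
  rw [mu_eq ha hb, lintegral_smul_measure,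
    lintegral_withDensity_eq_lintegral_mul_non_measurable _ (by fun_prop)
      (ae_of_all _ fun w => radialWeight_lt_top _)]
  rfl

lemma ae_mu_norm_lt_one : ∀ᵐ w ∂(mu n a b), ‖w‖ < 1 := by
  refine (withDensity_absolutelyContinuous _ _).ae_le ?_
  filter_upwards [ae_restrict_mem Metric.isOpen_ball.measurableSet] with w hw
  simpa using hw

lemma ae_mu_ne_zero (i : Fin n) : ∀ᵐ w ∂(mu n a b), w ≠ 0 := by
  have : Nontrivial (Cn n) := by
    have := i.pos
    apply Module.nontrivial_of_finrank_pos (R := ℝ)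
    rw [finrank_Cn]
    omega
  refine (withDensity_absolutelyContinuous _ _).ae_le ?_
  refine ae_restrict_of_ae ?_
  exact Measure.ae_ne volume 0

/-- This is the normalization of the Beta probability density. -/
lemma lintegral_beta {α β : ℝ} (hα : 0 < α) (hβ : 0 < β) :
    ∫⁻ x in Ioo (0 : ℝ) 1, ENNReal.ofReal (x ^ (α - 1) * (1 - x) ^ (β - 1)) =
      ENNReal.ofReal (ProbabilityTheory.beta α β) := by
  have hB := ProbabilityTheory.beta_pos hα hβ
  have h := ProbabilityTheory.lintegral_betaPDF_eq_one hα hβ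
  rw [ProbabilityTheory.lintegral_betaPDF] at h
  have h2 : ∀ x : ℝ, ENNReal.ofReal (1 / ProbabilityTheory.beta α β * x ^ (α - 1) *
      (1 - x) ^ (β - 1)) = ENNReal.ofReal (1 / ProbabilityTheory.beta α β) *
      ENNReal.ofReal (x ^ (α - 1) * (1 - x) ^ (β - 1)) := fun x => by
    rw [mul_assoc, ENNReal.ofReal_mul (by positivity)]
  simp only [h2] at h
  rw [lintegral_const_mul' _ _ ENNReal.ofReal_ne_top, one_div, ENNReal.ofReal_inv_of_pos hB] at h
  rw [← mul_one (ENNReal.ofReal (ProbabilityTheory.beta α β)), ← h, ← mul_assoc,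
    ENNReal.mul_inv_cancel (by simpa using hB) ENNReal.ofReal_ne_top, one_mul]

lemma lintegral_Ioi_radialWeight (m : ℕ) :
    ∫⁻ x in Ioi (0 : ℝ), ENNReal.ofReal (x ^ m) * radialWeight a b x =
      ∫⁻ x in Ioo (0 : ℝ) 1, ENNReal.ofReal (x ^ (m + b) * (1 - x) ^ a) := by
  have e : ∀ x ∈ Ioi (0 : ℝ), ENNReal.ofReal (x ^ m) * radialWeight a b x =
      (Iio 1).indicator (fun x => ENNReal.ofReal (x ^ (m + b) * (1 - x) ^ a)) x := by
    intro x hx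
    have hx0 : (0 : ℝ) < x := hx
    by_cases h1 : x ∈ Iio (1 : ℝ)
    · rw [radialWeight, indicator_of_mem h1, indicator_of_mem h1, ← ENNReal.ofReal_mul
        (by positivity), Real.rpow_add hx0, Real.rpow_natCast, mul_assoc]
    · rw [radialWeight, indicator_of_notMem h1, indicator_of_notMem h1, mul_zero]
  rw [setLIntegral_congr_fun measurableSet_Ioi e, setLIntegral_indicator measurableSet_Iio,
    Iio_inter_Ioi]

end Weight

/-! ### Unitary invariance and moments of the Hermitian product -/

section Moments

variable {n : ℕ} {t u : ℝ}

lemma herm_eq_inner (z w : Cn n) : herm z w = inner ℂ w z := by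
  simp [herm, PiLp.inner_apply]

lemma norm_herm_le (z w : Cn n) : ‖herm z w‖ ≤ ‖z‖ * ‖w‖ := by
  rw [herm_eq_inner, mul_comm]
  exact norm_inner_le_norm w z

lemma continuous_herm : Continuous fun p : Cn n × Cn n => herm p.1 p.2 := by
  simp only [herm_eq_inner]
  fun_prop

@[fun_prop]
lemma measurable_herm : Measurable fun p : Cn n × Cn n => herm p.1 p.2 :=
  continuous_herm.measurable

lemma measurePreserving_isometry (U : Cn n ≃ₗᵢ[ℂ] Cn n) :
    MeasurePreserving U (volume : Measure (Cn n)) volume := by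
  let V : Cn n ≃ₗᵢ[ℝ] Cn n :=
    { U.toLinearEquiv.restrictScalars ℝ with norm_map' := U.norm_map }
  exact V.measurePreserving

lemma lintegral_mu_isometry (ht : -1 < t) (hu : -(n : ℝ) < u) (U : Cn n ≃ₗᵢ[ℂ] Cn n)
    {F : Cn n → ℝ≥0∞} (hF : Measurable F) :
    ∫⁻ w, F (U w) ∂(mu n t u) = ∫⁻ w, F w ∂(mu n t u) := by
  rw [lintegral_mu ht hu, lintegral_mu ht hu, ← (measurePreserving_isometry U).lintegral_comp
    (f := fun w => radialWeight t u (‖w‖ ^ 2) * F w) (by fun_prop)]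
  simp only [LinearIsometryEquiv.norm_map]

/-- Extend z/|z| to an orthonormal basis with it in position i and take coordinates. Moments of
⟨z,w⟩ thereby reduce to moments of wᵢ. -/
lemma exists_isometry_norm_herm (i : Fin n) (z : Cn n) :
    ∃ U : Cn n ≃ₗᵢ[ℂ] Cn n, ∀ w, ‖herm z w‖ = ‖z‖ * ‖(U w) i‖ := by
  by_cases hz : z = 0
  · exact ⟨LinearIsometryEquiv.refl ℂ _, fun w => by simp [hz, herm]⟩
  have hz' : (‖z‖ : ℂ) ≠ 0 := by simpa using hz
  obtain ⟨B, hB⟩ := Orthonormal.exists_orthonormalBasis_extension_of_card_eq (𝕜 := ℂ)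
    (E := Cn n) (ι := Fin n) (by simp) (v := fun _ => (‖z‖⁻¹ : ℂ) • z) (s := {i}) (by
      constructor
      · rintro ⟨j, hj⟩
        simp [domRestrict, norm_smul, hz]
      · rintro ⟨j, hj⟩ ⟨j', hj'⟩ hne
        exact absurd (Subtype.ext ((mem_singleton_iff.1 hj).trans (mem_singleton_iff.1 hj').symm))
          hne)
  refine ⟨B.repr, fun w => ?_⟩
  have hz2 : z = (‖z‖ : ℂ) • B i := by
    rw [hB i rfl, smul_smul, mul_inv_cancel₀ hz', one_smul]
  rw [B.repr_apply_apply, herm_eq_inner]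
  conv_lhs => rw [hz2]
  rw [inner_smul_right, norm_mul, norm_inner_symm]
  simp

/-- The even moments of `w ↦ ⟨z, w⟩` with respect to `mu n t u`. -/
lemma exists_lintegral_norm_herm_pow (i : Fin n) (ht : -1 < t) (hu : -(n : ℝ) < u) :
    ∃ M : ℝ, 0 < M ∧ ∀ (k : ℕ) (z : Cn n),
      ∫⁻ w, ENNReal.ofReal (‖herm z w‖ ^ (2 * k)) ∂(mu n t u) =
        ENNReal.ofReal (M * (risingCoeff (n + u) k /
          (risingCoeff n k * risingCoeff (n + u + t + 1) k)) * ‖z‖ ^ (2 * k)) := by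
  obtain ⟨c, hc, h⟩ := exists_lintegral_coord i
  have hn : (0 : ℝ) < n := by exact_mod_cast i.pos
  have hΓ : ∀ {y : ℝ}, 0 < y → ∀ k : ℕ,
      Real.Gamma (y + k) = Real.Gamma y * (k.factorial * risingCoeff y k) := by
    intro y hy k
    induction k with
    | zero => simp [risingCoeff_zero]
    | succ k ih =>
      have hk : (0 : ℝ) < y + k := by positivity
      have := risingCoeff_succ y k
      push_cast [Nat.factorial_succ]
      rw [← add_assoc, Real.Gamma_add_one hk.ne', ih]
      linear_combination -(Real.Gamma y * k.factorial) * this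
  have h1 : 0 < n + u := by linarith
  have h2 : 0 < n + u + t + 1 := by linarith
  have g0 := Real.Gamma_pos_of_pos hn
  have g1 := Real.Gamma_pos_of_pos h1
  have g2 := Real.Gamma_pos_of_pos h2
  have g3 : 0 < Real.Gamma (t + 1) := Real.Gamma_pos_of_pos (by linarith)
  have hM := muConst_pos ht hu
  refine ⟨muConst n t u * c * (Real.Gamma (n + u) * Real.Gamma (t + 1) /
    (Real.Gamma n * Real.Gamma (n + u + t + 1))), by positivity, fun k z => ?_⟩
  obtain ⟨U, hU⟩ := exists_isometry_norm_herm i z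
  have e1 : ∀ w, ENNReal.ofReal (‖herm z w‖ ^ (2 * k)) =
      (fun w : Cn n => ENNReal.ofReal (‖z‖ ^ (2 * k)) * ENNReal.ofReal (‖w i‖ ^ (2 * k))) (U w) := by
    intro w
    simp only [hU, mul_pow]
    rw [ENNReal.ofReal_mul (by positivity)]
  rw [lintegral_congr e1, lintegral_mu_isometry ht hu U (F := fun w : Cn n =>
      ENNReal.ofReal (‖z‖ ^ (2 * k)) * ENNReal.ofReal (‖w i‖ ^ (2 * k))) (by fun_prop),
    lintegral_const_mul' _ _ ENNReal.ofReal_ne_top, lintegral_mu ht hu]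
  simp only [mul_comm (radialWeight t u _)]
  rw [h k _ measurable_radialWeight, lintegral_Ioi_radialWeight]
  have e2 : ((n + k - 1 : ℕ) : ℝ) + u = (n + u + k) - 1 := by
    rw [Nat.cast_sub (by have := i.pos; omega)]
    push_cast
    ring
  have e3 : t = (t + 1) - 1 := by ring
  have hk : 0 < n + u + k := by linarith [(Nat.cast_nonneg k : (0 : ℝ) ≤ k)]
  have hB := lintegral_beta hk (by linarith : 0 < t + 1)
  rw [← e2, ← e3] at hB
  rw [hB]
  have hg := Real.Gamma_pos_of_pos (show (0 : ℝ) < (n + k : ℕ) by push_cast; positivity)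
  rw [← ENNReal.ofReal_mul (by positivity), ← ENNReal.ofReal_mul hM.le,
    ← ENNReal.ofReal_mul (by positivity)]
  congr 1
  have e4 : n + u + k + (t + 1) = n + u + t + 1 + k := by ring
  -- The moment is k!/Γ(n+k) times the Beta value Γ(n+u+k) Γ(t+1) / Γ(n+u+t+1+k). Writing each
  -- Γ(y+k) as Γ(y) k! times a rising coefficient separates the dependence on k.
  rw [ProbabilityTheory.beta, e4, hΓ h1, hΓ h2, Nat.cast_add, hΓ hn]
  have r0 := (risingCoeff_pos hn k).ne'
  have r1 := (risingCoeff_pos h1 k).ne'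
  have r2 := (risingCoeff_pos h2 k).ne'
  field_simp

end Moments

/-! ### Parseval's identity on circles -/

section Parseval

lemma integral_conj_exp_pow_mul_exp_pow (m k : ℕ) :
    ∫ θ in Ioc 0 (2 * Real.pi), (starRingEnd ℂ) (Complex.exp (θ * Complex.I) ^ m) *
      Complex.exp (θ * Complex.I) ^ k = if k = m then (2 * Real.pi : ℂ) else 0 := by
  have e : ∀ θ : ℝ, (starRingEnd ℂ) (Complex.exp (θ * Complex.I) ^ m) *
      Complex.exp (θ * Complex.I) ^ k = Complex.exp ((((k : ℤ) - m : ℤ) * Complex.I) * θ) := by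
    intro θ
    rw [map_pow, ← Complex.exp_conj, ← Complex.exp_nat_mul, ← Complex.exp_nat_mul,
      ← Complex.exp_add]
    congr 1
    simp only [map_mul, Complex.conj_ofReal, Complex.conj_I]
    push_cast
    ring
  simp only [e]
  rw [← intervalIntegral.integral_of_le (by positivity)]
  split_ifs with h
  · simp [h]
  · have hc : ((((k : ℤ) - m : ℤ) : ℂ) * Complex.I) ≠ 0 := by
      refine mul_ne_zero ?_ Complex.I_ne_zero
      rw [Int.cast_ne_zero]
      omega
    rw [integral_exp_mul_complex hc]
    have h1 : Complex.exp ((((k : ℤ) - m : ℤ) * Complex.I) * ((2 * Real.pi : ℝ) : ℂ)) = 1 := by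
      rw [← Complex.exp_int_mul_two_pi_mul_I ((k : ℤ) - m)]
      congr 1
      push_cast
      ring
    rw [h1]
    simp

/-- **Parseval's identity** for an absolutely convergent power series on the unit circle. -/
lemma lintegral_norm_sq_tsum {u : ℕ → ℂ} (hu : Summable fun k => ‖u k‖) :
    ∫⁻ θ in Ioc 0 (2 * Real.pi),
      ENNReal.ofReal (‖∑' k, u k * Complex.exp (θ * Complex.I) ^ k‖ ^ 2) =
        ENNReal.ofReal (2 * Real.pi) * ∑' k, ENNReal.ofReal (‖u k‖ ^ 2) := by
  set e : ℝ → ℂ := fun θ => Complex.exp (θ * Complex.I) with he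
  have hec : Continuous e := by fun_prop
  have hen : ∀ θ (k : ℕ), ‖e θ ^ k‖ = 1 := fun θ k => by
    rw [norm_pow, he, Complex.norm_exp_ofReal_mul_I, one_pow]
  set f : ℝ → ℂ := fun θ => ∑' k, u k * e θ ^ k with hf
  have hfc : Continuous f := continuous_tsum (fun k => by fun_prop) hu fun k θ => by
    rw [norm_mul, hen, mul_one]
  set S := ∑' k, ‖u k‖ with hS
  have hfS : ∀ θ, ‖f θ‖ ≤ S := fun θ =>
    tsum_of_norm_bounded hu.hasSum fun k => by rw [norm_mul, hen, mul_one]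
  have hint : ∀ {g : ℝ → ℂ}, Continuous g → IntegrableOn g (Ioc 0 (2 * Real.pi)) :=
    fun hg => hg.integrableOn_Ioc
  have hvol : (volume : Measure ℝ).real (Ioc 0 (2 * Real.pi)) = 2 * Real.pi := by
    rw [Real.volume_real_Ioc_of_le (by positivity), sub_zero]
  have hconst : ∀ {g : ℝ → ℂ} {c : ℝ}, (∀ θ, ‖g θ‖ ≤ c) → Continuous g →
      ∫ θ in Ioc 0 (2 * Real.pi), ‖g θ‖ ≤ c * (2 * Real.pi) := by
    intro g c hg hgc
    calc ∫ θ in Ioc 0 (2 * Real.pi), ‖g θ‖ ≤ ∫ θ in Ioc 0 (2 * Real.pi), c :=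
          setIntegral_mono hgc.norm.integrableOn_Ioc continuous_const.integrableOn_Ioc fun θ => hg θ
      _ = c * (2 * Real.pi) := by
          rw [setIntegral_const, hvol, smul_eq_mul, mul_comm]
  -- Fourier coefficients of f, by termwise integration and orthogonality.
  have h1 : ∀ m : ℕ, ∫ θ in Ioc 0 (2 * Real.pi), (starRingEnd ℂ) (e θ ^ m) * f θ =
      2 * Real.pi * u m := by
    intro m
    have hF := hasSum_integral_of_summable_integral_norm
      (μ := volume.restrict (Ioc 0 (2 * Real.pi)))
      (F := fun k θ => u k * ((starRingEnd ℂ) (e θ ^ m) * e θ ^ k))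
      (fun k => hint (by fun_prop))
      (Summable.of_nonneg_of_le (fun k => integral_nonneg fun θ => norm_nonneg _)
        (fun k => hconst (c := ‖u k‖) (fun θ => by
          rw [norm_mul, norm_mul, RCLike.norm_conj, hen, hen, mul_one, mul_one]) (by fun_prop))
        (hu.mul_right _))
    have hval : ∀ k, ∫ θ in Ioc 0 (2 * Real.pi), u k * ((starRingEnd ℂ) (e θ ^ m) * e θ ^ k) =
        if k = m then 2 * Real.pi * u m else 0 := by
      intro k
      rw [integral_const_mul, integral_conj_exp_pow_mul_exp_pow]
      split_ifs with h
      · rw [h, mul_comm]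
      · rw [mul_zero]
    simp only [hval] at hF
    rw [← hF.tsum_eq.symm.trans (tsum_ite_eq m _)]
    refine integral_congr_ae (ae_of_all _ fun θ => ?_)
    simp only [hf]
    rw [← tsum_mul_left]
    exact tsum_congr fun k => by ring
  -- Expand only the conjugate factor of |f|² and integrate termwise; each term is then given by
  -- `h1`.
  have h2 := hasSum_integral_of_summable_integral_norm
      (μ := volume.restrict (Ioc 0 (2 * Real.pi)))
      (F := fun m θ => (starRingEnd ℂ) (u m) * ((starRingEnd ℂ) (e θ ^ m) * f θ))
      (fun m => hint (by fun_prop))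
      (Summable.of_nonneg_of_le (fun k => integral_nonneg fun θ => norm_nonneg _)
        (fun k => hconst (c := ‖u k‖ * S) (fun θ => by
          rw [norm_mul, norm_mul, RCLike.norm_conj, RCLike.norm_conj, hen, one_mul]
          gcongr
          exact hfS θ) (by fun_prop))
        ((hu.mul_right _).mul_right _))
  have h3 : ∀ m, ∫ θ in Ioc 0 (2 * Real.pi),
      (starRingEnd ℂ) (u m) * ((starRingEnd ℂ) (e θ ^ m) * f θ) =
      ((2 * Real.pi * ‖u m‖ ^ 2 : ℝ) : ℂ) := by
    intro m
    rw [integral_const_mul, h1 m]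
    push_cast
    rw [← Complex.conj_mul']
    ring
  have h4 : ∀ θ, ∑' m, (starRingEnd ℂ) (u m) * ((starRingEnd ℂ) (e θ ^ m) * f θ) =
      ((‖f θ‖ ^ 2 : ℝ) : ℂ) := by
    intro θ
    have : (starRingEnd ℂ) (f θ) = ∑' m, (starRingEnd ℂ) (u m) * (starRingEnd ℂ) (e θ ^ m) := by
      rw [hf, Complex.conj_tsum]
      simp only [map_mul]
    push_cast
    rw [← Complex.conj_mul', this, ← tsum_mul_right]
    exact tsum_congr fun k => by ring
  simp only [h3, h4] at h2
  rw [integral_complex_ofReal, Complex.hasSum_ofReal] at h2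
  rw [← ofReal_integral_eq_lintegral_ofReal (by
    exact (hfc.norm.pow 2).integrableOn_Ioc) (ae_of_all _ fun θ => by positivity),
    ← h2.tsum_eq, ENNReal.ofReal_tsum_of_nonneg (fun m => by positivity) h2.summable,
    ← ENNReal.tsum_mul_left]
  exact tsum_congr fun m => ENNReal.ofReal_mul (by positivity)

/-- The integrand is the squared modulus of the binomial series of (1 - e^{iθ}ξ)^{-s}, to which
Parseval applies. -/
lemma lintegral_circle_one_sub (s : ℝ) {ξ : ℂ} (hξ : ‖ξ‖ < 1) :
    ∫⁻ θ in Ioc 0 (2 * Real.pi),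
      ENNReal.ofReal (‖1 - Complex.exp ((θ : ℝ) * Complex.I) * ξ‖ ^ (-(2 * s))) =
        ENNReal.ofReal (2 * Real.pi) *
          ∑' k, ENNReal.ofReal (risingCoeff s k ^ 2 * ‖ξ‖ ^ (2 * k)) := by
  obtain ⟨C, _, hC⟩ := abs_risingCoeff_le s
  have h := lintegral_norm_sq_tsum (summable_norm_mul_pow_of_abs_le hC hξ)
  have e1 : ∀ k, ‖(risingCoeff s k : ℂ) * ξ ^ k‖ ^ 2 = risingCoeff s k ^ 2 * ‖ξ‖ ^ (2 * k) := by
    intro k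
    rw [norm_mul, norm_pow, Complex.norm_real, Real.norm_eq_abs, mul_pow, sq_abs]
    ring
  simp only [e1] at h
  rw [← h]
  refine lintegral_congr fun θ => ?_
  have hθ : ‖Complex.exp ((θ : ℝ) * Complex.I) * ξ‖ < 1 := by
    rwa [norm_mul, Complex.norm_exp_ofReal_mul_I, one_mul]
  have h2 := (hasSum_one_sub_cpow_neg s hθ).tsum_eq
  have e2 : ∀ k, (risingCoeff s k : ℂ) * ξ ^ k * Complex.exp ((θ : ℝ) * Complex.I) ^ k =
      risingCoeff s k * (Complex.exp ((θ : ℝ) * Complex.I) * ξ) ^ k := fun k => by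
    rw [mul_pow]
    ring
  simp only [e2]
  rw [h2, norm_div, norm_one, Complex.norm_cpow_real, one_div, ← Real.rpow_neg (norm_nonneg _),
    ← Real.rpow_two, ← Real.rpow_mul (norm_nonneg _)]
  congr 2
  ring

end Parseval

/-! ### Forelli-Rudin integrals -/

section ForelliRudin

variable {n : ℕ} {t u : ℝ}

/-- Multiplication by a unimodular scalar as an isometry. -/
def phaseIsometry (n : ℕ) (θ : ℝ) : Cn n ≃ₗᵢ[ℂ] Cn n :=
  LinearIsometryEquiv.mk
    (LinearEquiv.smulOfNeZero ℂ (Cn n) (Complex.exp (-(θ : ℂ) * Complex.I)) (Complex.exp_ne_zero _))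
    fun w => by
      have : ‖Complex.exp (-(θ : ℂ) * Complex.I)‖ = 1 := by
        rw [← Complex.ofReal_neg, Complex.norm_exp_ofReal_mul_I]
      change ‖Complex.exp (-(θ : ℂ) * Complex.I) • w‖ = ‖w‖
      rw [norm_smul, this, one_mul]

/-- Conjugation in the second variable undoes the minus sign in `phaseIsometry`. -/
lemma herm_phaseIsometry (θ : ℝ) (z w : Cn n) :
    herm z (phaseIsometry n θ w) = Complex.exp (θ * Complex.I) * herm z w := by
  have : phaseIsometry n θ w = Complex.exp (-(θ : ℂ) * Complex.I) • w := rfl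
  rw [this, herm_eq_inner, inner_smul_left, ← Complex.exp_conj, herm_eq_inner]
  simp

lemma isFiniteMeasure_mu (ht : -1 < t) (hu : -(n : ℝ) < u) (i : Fin n) :
    IsFiniteMeasure (mu n t u) := by
  obtain ⟨M, _, h⟩ := exists_lintegral_norm_herm_pow i ht hu
  have h0 := h 0 0
  simp only [mul_zero, pow_zero, ENNReal.ofReal_one, lintegral_one] at h0
  exact ⟨h0 ▸ ENNReal.ofReal_lt_top⟩

/-- The measure is invariant under w ↦ e^{-iθ}w, so the integral equals its average over θ. Tonelli
moves that average inside, where Parseval leaves only the diagonal terms |⟨z,w⟩|^{2k}. -/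
lemma lintegral_one_sub_herm (i : Fin n) (ht : -1 < t) (hu : -(n : ℝ) < u) (s : ℝ)
    {z : Cn n} (hz : ‖z‖ < 1) :
    ∫⁻ w, ENNReal.ofReal (‖1 - herm z w‖ ^ (-(2 * s))) ∂(mu n t u) =
      ∑' k, ENNReal.ofReal (risingCoeff s k ^ 2) *
        ∫⁻ w, ENNReal.ofReal (‖herm z w‖ ^ (2 * k)) ∂(mu n t u) := by
  have := isFiniteMeasure_mu ht hu i
  have hpi : ENNReal.ofReal (2 * Real.pi) ≠ 0 := by
    simpa using Real.pi_pos
  have h1 : ∀ θ : ℝ, ∫⁻ w, ENNReal.ofReal (‖1 - herm z w‖ ^ (-(2 * s))) ∂(mu n t u) =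
      ∫⁻ w, ENNReal.ofReal (‖1 - Complex.exp (θ * Complex.I) * herm z w‖ ^ (-(2 * s)))
        ∂(mu n t u) := by
    intro θ
    rw [← lintegral_mu_isometry ht hu (phaseIsometry n θ) (by fun_prop)]
    simp only [herm_phaseIsometry]
  have h2 : ENNReal.ofReal (2 * Real.pi) *
      ∫⁻ w, ENNReal.ofReal (‖1 - herm z w‖ ^ (-(2 * s))) ∂(mu n t u) =
      ENNReal.ofReal (2 * Real.pi) * ∑' k, ENNReal.ofReal (risingCoeff s k ^ 2) *
        ∫⁻ w, ENNReal.ofReal (‖herm z w‖ ^ (2 * k)) ∂(mu n t u) := by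
    calc _ = ∫⁻ _ in Ioc 0 (2 * Real.pi),
          ∫⁻ w, ENNReal.ofReal (‖1 - herm z w‖ ^ (-(2 * s))) ∂(mu n t u) := by
          rw [setLIntegral_const, Real.volume_Ioc, sub_zero, mul_comm]
      _ = ∫⁻ θ in Ioc 0 (2 * Real.pi), ∫⁻ w,
          ENNReal.ofReal (‖1 - Complex.exp ((θ : ℝ) * Complex.I) * herm z w‖ ^ (-(2 * s)))
            ∂(mu n t u) := lintegral_congr fun θ => h1 θ
      _ = ∫⁻ w, (∫⁻ θ in Ioc 0 (2 * Real.pi),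
          ENNReal.ofReal (‖1 - Complex.exp ((θ : ℝ) * Complex.I) * herm z w‖ ^ (-(2 * s))))
            ∂(mu n t u) := by
          refine lintegral_lintegral_swap (Measurable.aemeasurable ?_)
          simp only [Function.uncurry_def]
          fun_prop
      _ = ∫⁻ w, ENNReal.ofReal (2 * Real.pi) *
          ∑' k, ENNReal.ofReal (risingCoeff s k ^ 2 * ‖herm z w‖ ^ (2 * k)) ∂(mu n t u) := by
          refine lintegral_congr_ae ?_
          filter_upwards [ae_mu_norm_lt_one] with w hw
          refine lintegral_circle_one_sub s ?_
          exact (norm_herm_le z w).trans_lt (mul_lt_one_of_nonneg_of_lt_one_left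
            (norm_nonneg _) hz hw.le)
      _ = _ := by
          rw [lintegral_const_mul' _ _ ENNReal.ofReal_ne_top, lintegral_tsum
            (fun k => by fun_prop)]
          congr 1
          refine tsum_congr fun k => ?_
          rw [← lintegral_const_mul' _ _ ENNReal.ofReal_ne_top]
          exact lintegral_congr fun w => ENNReal.ofReal_mul (by positivity)
  exact (ENNReal.mul_right_inj hpi ENNReal.ofReal_ne_top).1 h2

lemma hasSum_one_sub_rpow_neg (s : ℝ) {x : ℝ} (h0 : 0 ≤ x) (hx : x < 1) :
    HasSum (fun k => risingCoeff s k * x ^ k) ((1 - x) ^ (-s)) := by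
  have h := hasSum_one_sub_cpow_neg s (ξ := (x : ℂ)) (by
    rwa [Complex.norm_real, Real.norm_of_nonneg h0])
  rw [← Complex.hasSum_ofReal]
  convert h using 1
  · ext k
    push_cast
    rfl
  · rw [Real.rpow_neg (by linarith), Complex.ofReal_inv, Complex.ofReal_cpow (by linarith), one_div]
    push_cast
    rfl

/-- Two-sided comparison of the Taylor coefficients of the Forelli-Rudin integral. -/
lemma exists_forelliRudin_coeff_bounds (i : Fin n) (ht : -1 < t) (hu : -(n : ℝ) < u) {s : ℝ}
    (hs : 0 ≤ s) : ∃ c C : ℝ, 0 < c ∧ 0 < C ∧ ∀ k : ℕ,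
      c * ((k : ℝ) + 1) ^ (s - 1) ≤ risingCoeff ((n + 1 + t + s) / 2) k ^ 2 *
        (risingCoeff (n + u) k / (risingCoeff n k * risingCoeff (n + u + t + 1) k)) ∧
      risingCoeff ((n + 1 + t + s) / 2) k ^ 2 *
        (risingCoeff (n + u) k / (risingCoeff n k * risingCoeff (n + u + t + 1) k)) ≤
          C * ((k : ℝ) + 1) ^ (s - 1) := by
  have hn : (0 : ℝ) < n := by exact_mod_cast i.pos
  have hL : 0 < (n + 1 + t + s) / 2 := by linarith
  have h1 : 0 < n + u := by linarith
  have h2 : 0 < n + u + t + 1 := by linarith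
  obtain ⟨c0, C0, hc0, hC0, H0⟩ := risingCoeff_bounds hL
  obtain ⟨c1, C1, hc1, hC1, H1⟩ := risingCoeff_bounds h1
  obtain ⟨c2, C2, hc2, hC2, H2⟩ := risingCoeff_bounds hn
  obtain ⟨c3, C3, hc3, hC3, H3⟩ := risingCoeff_bounds h2
  -- Exponent count: (n+1+t+s-2) + (n+u-1) - (n-1) - (n+u+t) = s - 1.
  have key : ∀ (k : ℕ) (a0 a1 a2 a3 : ℝ), (a0 * ((k : ℝ) + 1) ^ ((n + 1 + t + s) / 2 - 1)) ^ 2 *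
      ((a1 * ((k : ℝ) + 1) ^ (n + u - 1)) / ((a2 * ((k : ℝ) + 1) ^ ((n : ℝ) - 1)) *
        (a3 * ((k : ℝ) + 1) ^ (n + u + t + 1 - 1)))) =
      a0 ^ 2 * (a1 / (a2 * a3)) * ((k : ℝ) + 1) ^ (s - 1) := by
    intro k a0 a1 a2 a3
    have hk : (0 : ℝ) < (k : ℝ) + 1 := by positivity
    have e : ((k : ℝ) + 1) ^ (s - 1) = (((k : ℝ) + 1) ^ ((n + 1 + t + s) / 2 - 1)) ^ 2 *
        ((k : ℝ) + 1) ^ (n + u - 1) / (((k : ℝ) + 1) ^ ((n : ℝ) - 1) *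
        ((k : ℝ) + 1) ^ (n + u + t + 1 - 1)) := by
      rw [← Real.rpow_natCast, ← Real.rpow_mul hk.le, ← Real.rpow_add hk, ← Real.rpow_add hk,
        ← Real.rpow_sub hk]
      congr 1
      push_cast
      ring
    rw [e, mul_pow]
    ring
  refine ⟨c0 ^ 2 * (c1 / (C2 * C3)), C0 ^ 2 * (C1 / (c2 * c3)), by positivity, by positivity,
    fun k => ⟨?_, ?_⟩⟩
  all_goals
    have p0 := risingCoeff_pos hL k
    have p1 := risingCoeff_pos h1 k
    have p2 := risingCoeff_pos hn k
    have p3 := risingCoeff_pos h2 k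
    have hk : (0 : ℝ) < (k : ℝ) + 1 := by positivity
    rw [← key]
    gcongr
    all_goals first
      | exact (H0 k).1 | exact (H0 k).2 | exact (H1 k).1 | exact (H1 k).2
      | exact (H2 k).1 | exact (H2 k).2 | exact (H3 k).1 | exact (H3 k).2

/-- Common source of the upper estimate for s > 0 and of the divergence at s = 0. -/
lemma exists_lintegral_one_sub_herm_eq (i : Fin n) (ht : -1 < t) (hu : -(n : ℝ) < u) {s : ℝ}
    (hs : 0 ≤ s) : ∃ (A : ℕ → ℝ) (c C : ℝ), 0 < c ∧ 0 < C ∧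
      (∀ k : ℕ, c * ((k : ℝ) + 1) ^ (s - 1) ≤ A k ∧ A k ≤ C * ((k : ℝ) + 1) ^ (s - 1)) ∧
      ∀ z : Cn n, ‖z‖ < 1 →
        ∫⁻ w, ENNReal.ofReal (‖1 - herm z w‖ ^ (-(n + 1 + t + s))) ∂(mu n t u) =
          ∑' k, ENNReal.ofReal (A k * (‖z‖ ^ 2) ^ k) := by
  obtain ⟨M, hM, hmom⟩ := exists_lintegral_norm_herm_pow i ht hu
  obtain ⟨c, C, hc, hC, h⟩ := exists_forelliRudin_coeff_bounds i ht hu hs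
  refine ⟨fun k => M * (risingCoeff ((n + 1 + t + s) / 2) k ^ 2 *
    (risingCoeff (n + u) k / (risingCoeff n k * risingCoeff (n + u + t + 1) k))), M * c, M * C,
    by positivity, by positivity, fun k => ⟨?_, ?_⟩, fun z hz => ?_⟩
  · rw [mul_assoc]
    exact mul_le_mul_of_nonneg_left (h k).1 hM.le
  · rw [mul_assoc]
    exact mul_le_mul_of_nonneg_left (h k).2 hM.le
  · have h1 := lintegral_one_sub_herm i ht hu ((n + 1 + t + s) / 2) hz
    rw [mul_div_cancel₀ _ two_ne_zero] at h1
    rw [h1]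
    refine tsum_congr fun k => ?_
    rw [hmom, ← ENNReal.ofReal_mul (by positivity), ← pow_mul]
    congr 1
    ring

/-- The **Forelli-Rudin estimate**. -/
lemma exists_lintegral_one_sub_herm_le (i : Fin n) (ht : -1 < t) (hu : -(n : ℝ) < u) {s : ℝ}
    (hs : 0 < s) : ∃ C : ℝ, 0 < C ∧ ∀ z : Cn n, ‖z‖ < 1 →
      ∫⁻ w, ENNReal.ofReal (‖1 - herm z w‖ ^ (-(n + 1 + t + s))) ∂(mu n t u) ≤
        ENNReal.ofReal (C * (1 - ‖z‖ ^ 2) ^ (-s)) := by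
  obtain ⟨A, c, C, hc, hC, hA, h⟩ := exists_lintegral_one_sub_herm_eq i ht hu hs.le
  -- The coefficients of (1-x)^{-s} grow like (k+1)^{s-1} as well, so the two series compare term by
  -- term.
  obtain ⟨d, D, hd, hD, hs'⟩ := risingCoeff_bounds hs
  refine ⟨C / d, by positivity, fun z hz => ?_⟩
  have hz2 : ‖z‖ ^ 2 < 1 := (sq_lt_one_iff₀ (norm_nonneg _)).2 hz
  have hsum := (hasSum_one_sub_rpow_neg s (sq_nonneg ‖z‖) hz2).mul_left (C / d)
  rw [h z hz, ← hsum.tsum_eq, ENNReal.ofReal_tsum_of_nonneg (fun k => by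
    have := risingCoeff_pos hs k
    positivity) hsum.summable]
  refine ENNReal.tsum_le_tsum fun k => ENNReal.ofReal_le_ofReal ?_
  rw [← mul_assoc]
  refine mul_le_mul_of_nonneg_right ?_ (by positivity)
  calc A k ≤ C * ((k : ℝ) + 1) ^ (s - 1) := (hA k).2
    _ = C / d * (d * ((k : ℝ) + 1) ^ (s - 1)) := by field_simp
    _ ≤ C / d * risingCoeff s k := by
        gcongr
        exact (hs' k).1

/-- In the critical case the Forelli-Rudin integral is unbounded near the sphere. -/
lemma exists_le_lintegral_one_sub_herm (i : Fin n) (ht : -1 < t) (hu : -(n : ℝ) < u) (R : ℝ) :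
    ∃ r : ℝ, r < 1 ∧ ∀ z : Cn n, r < ‖z‖ → ‖z‖ < 1 → ENNReal.ofReal R ≤
      ∫⁻ w, ENNReal.ofReal (‖1 - herm z w‖ ^ (-(n + 1 + t))) ∂(mu n t u) := by
  obtain ⟨A, c, C, hc, hC, hA, h⟩ := exists_lintegral_one_sub_herm_eq i ht hu (s := 0) le_rfl
  -- At s = 0 the coefficients dominate c/(k+1), and the harmonic series diverges. The 2 in 2R/c
  -- pays for the loss |z|^{2k} ≥ |z|^{2N} > 1/2 in the first N terms.
  have hdiv : Tendsto (fun N : ℕ => ∑ k ∈ Finset.range N, (1 / ((k : ℝ) + 1))) atTop atTop :=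
    Real.tendsto_sum_range_one_div_nat_succ_atTop
  obtain ⟨N, hN⟩ := (hdiv.eventually_ge_atTop (2 * R / c)).exists
  have hlim : Tendsto (fun x : ℝ => (x ^ 2) ^ N) (𝓝 1) (𝓝 1) := by
    have : Continuous fun x : ℝ => (x ^ 2) ^ N := by fun_prop
    simpa using this.tendsto 1
  obtain ⟨δ, hδ, hball⟩ := Metric.eventually_nhds_iff.1
    (hlim.eventually (lt_mem_nhds (by norm_num : (1 / 2 : ℝ) < 1)))
  refine ⟨1 - δ, by linarith, fun z hz1 hz2 => ?_⟩
  have hzN : 1 / 2 < (‖z‖ ^ 2) ^ N := hball (by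
    rw [Real.dist_eq, abs_sub_lt_iff]
    constructor <;> linarith)
  have hz' : ‖z‖ ^ 2 ≤ 1 := pow_le_one₀ (norm_nonneg _) hz2.le
  have h' := h z hz2
  rw [add_zero] at h'
  rw [h']
  refine le_trans ?_ (ENNReal.sum_le_tsum (Finset.range N))
  have hA0 : ∀ k : ℕ, c * (1 / ((k : ℝ) + 1)) ≤ A k := fun k => by
    have := (hA k).1
    rwa [zero_sub, Real.rpow_neg_one, ← one_div] at this
  have hA1 : ∀ k, 0 ≤ A k := fun k => le_trans (by positivity) (hA0 k)
  rw [← ENNReal.ofReal_sum_of_nonneg fun k _ => mul_nonneg (hA1 k) (by positivity)]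
  refine ENNReal.ofReal_le_ofReal ?_
  calc R = c / 2 * (2 * R / c) := by field_simp
    _ ≤ c / 2 * ∑ k ∈ Finset.range N, (1 / ((k : ℝ) + 1)) := by gcongr
    _ = ∑ k ∈ Finset.range N, c * (1 / ((k : ℝ) + 1)) * (1 / 2) := by
        rw [Finset.mul_sum]
        exact Finset.sum_congr rfl fun k _ => by ring
    _ ≤ ∑ k ∈ Finset.range N, A k * (‖z‖ ^ 2) ^ k := by
        refine Finset.sum_le_sum fun k hk => ?_
        refine mul_le_mul (hA0 k) (hzN.le.trans ?_) (by norm_num) (hA1 k)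
        exact pow_le_pow_of_le_one (by positivity) hz' (Finset.mem_range.1 hk).le

end ForelliRudin

/-! ### Schur tests and comparison of integral operators -/

section Operators

variable {X : Type*} [MeasurableSpace X] {μ ν : Measure X}

/-- **Schur's test**, for a nonnegative kernel and with constants. -/
lemma lintegral_rpow_le_of_schur [SFinite μ] {k : X → X → ℝ≥0∞}
    (hk : Measurable (Function.uncurry k)) {h : X → ℝ≥0∞} (hh : Measurable h)
    (h0 : ∀ᵐ w ∂μ, h w ≠ 0 ∧ h w ≠ ∞) {p q : ℝ} (hpq : p.HolderConjugate q) {C D : ℝ≥0∞}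
    (h1 : ∀ᵐ z ∂μ, ∫⁻ w, k z w * h w ^ q ∂μ ≤ C * h z ^ q)
    (h2 : ∀ᵐ w ∂μ, ∫⁻ z, k z w * h z ^ p ∂μ ≤ D * h w ^ p)
    {F : X → ℝ≥0∞} (hF : Measurable F) :
    ∫⁻ z, (∫⁻ w, k z w * F w ∂μ) ^ p ∂μ ≤ C ^ (p / q) * D * ∫⁻ w, F w ^ p ∂μ := by
  have hp := hpq.pos
  have hq := hpq.symm.pos
  have hpq1 : q⁻¹ + p⁻¹ = 1 := by rw [add_comm]; exact hpq.inv_add_inv_eq_one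
  have hk1 : ∀ z, Measurable (k z) := fun z => hk.comp measurable_prodMk_left
  have key : ∀ᵐ z ∂μ, (∫⁻ w, k z w * F w ∂μ) ^ p ≤
      ∫⁻ w, C ^ (p / q) * (h z ^ p * k z w * (F w ^ p * (h w ^ p)⁻¹)) ∂μ := by
    filter_upwards [h1] with z hz
    -- Split k F as (k^{1/q} h)(k^{1/p} F h⁻¹) for Hölder; the first factor then meets the row
    -- condition `h1`.
    have e : ∫⁻ w, k z w * F w ∂μ =
        ∫⁻ w, ((fun w => k z w ^ q⁻¹ * h w) * fun w => k z w ^ p⁻¹ * (F w * (h w)⁻¹)) w ∂μ := by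
      refine lintegral_congr_ae ?_
      filter_upwards [h0] with w hw
      rw [Pi.mul_apply]
      calc k z w * F w = k z w ^ (q⁻¹ + p⁻¹) * F w * (h w * (h w)⁻¹) := by
            rw [hpq1, ENNReal.rpow_one, ENNReal.mul_inv_cancel hw.1 hw.2, mul_one]
        _ = _ := by
            rw [ENNReal.rpow_add_of_nonneg _ _ (by positivity) (by positivity)]
            ring
    rw [e]
    calc _ ≤ ((∫⁻ w, (k z w ^ q⁻¹ * h w) ^ q ∂μ) ^ (1 / q) *
          (∫⁻ w, (k z w ^ p⁻¹ * (F w * (h w)⁻¹)) ^ p ∂μ) ^ (1 / p)) ^ p := by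
          gcongr
          exact ENNReal.lintegral_mul_le_Lp_mul_Lq μ hpq.symm
            (((hk1 z).pow_const _).mul hh).aemeasurable
            (((hk1 z).pow_const _).mul (hF.mul hh.inv)).aemeasurable
      _ = (∫⁻ w, k z w * h w ^ q ∂μ) ^ (p / q) *
          ∫⁻ w, k z w * (F w ^ p * (h w ^ p)⁻¹) ∂μ := by
          rw [ENNReal.mul_rpow_of_nonneg _ _ hp.le, ← ENNReal.rpow_mul, ← ENNReal.rpow_mul,
            one_div_mul_cancel hp.ne', ENNReal.rpow_one, one_div, inv_mul_eq_div]
          congr 2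
          · refine lintegral_congr fun w => ?_
            rw [ENNReal.mul_rpow_of_nonneg _ _ hq.le, ← ENNReal.rpow_mul,
              inv_mul_cancel₀ hq.ne', ENNReal.rpow_one]
          · ext w
            rw [ENNReal.mul_rpow_of_nonneg _ _ hp.le, ← ENNReal.rpow_mul,
              inv_mul_cancel₀ hp.ne', ENNReal.rpow_one, ENNReal.mul_rpow_of_nonneg _ _ hp.le,
              ENNReal.inv_rpow]
      _ ≤ (C * h z ^ q) ^ (p / q) * ∫⁻ w, k z w * (F w ^ p * (h w ^ p)⁻¹) ∂μ := by
          gcongr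
      _ = _ := by
          have hpq' : q * (p / q) = p := by field_simp
          rw [ENNReal.mul_rpow_of_nonneg _ _ (by positivity), ← ENNReal.rpow_mul, hpq',
            ← lintegral_const_mul _ (by
              have := hk1 z
              fun_prop)]
          exact lintegral_congr fun w => by ring
  -- After Tonelli the inner integral is the one in the column condition `h2`, and the powers of h
  -- cancel.
  calc _ ≤ ∫⁻ z, ∫⁻ w, C ^ (p / q) * (h z ^ p * k z w * (F w ^ p * (h w ^ p)⁻¹)) ∂μ ∂μ :=
        lintegral_mono_ae key
    _ = ∫⁻ w, ∫⁻ z, C ^ (p / q) * (h z ^ p * k z w * (F w ^ p * (h w ^ p)⁻¹)) ∂μ ∂μ := by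
        refine lintegral_lintegral_swap (Measurable.aemeasurable ?_)
        have hk' : Measurable fun x : X × X => k x.1 x.2 := hk
        simp only [Function.uncurry_def]
        fun_prop
    _ ≤ ∫⁻ w, C ^ (p / q) * D * F w ^ p ∂μ := by
        refine lintegral_mono_ae ?_
        filter_upwards [h2, h0] with w hw hw0
        have hm : Measurable fun z => k z w * h z ^ p :=
          (hk.comp measurable_prodMk_right).mul (hh.pow_const p)
        have hne : h w ^ p ≠ 0 := by
          simp [ENNReal.rpow_eq_zero_iff, hw0.1, hw0.2]
        have hnt : h w ^ p ≠ ∞ := by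
          simp [ENNReal.rpow_eq_top_iff, hw0.1, hw0.2]
        calc _ = ∫⁻ z, C ^ (p / q) * (F w ^ p * (h w ^ p)⁻¹) * (k z w * h z ^ p) ∂μ :=
              lintegral_congr fun z => by ring
          _ = C ^ (p / q) * (F w ^ p * (h w ^ p)⁻¹) * ∫⁻ z, k z w * h z ^ p ∂μ :=
              lintegral_const_mul _ hm
          _ ≤ C ^ (p / q) * (F w ^ p * (h w ^ p)⁻¹) * (D * h w ^ p) := by gcongr
          _ = C ^ (p / q) * D * F w ^ p * (h w ^ p * (h w ^ p)⁻¹) := by ring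
          _ = _ := by rw [ENNReal.mul_inv_cancel hne hnt, mul_one]
    _ = _ := lintegral_const_mul _ (by fun_prop)

/-- Endpoint p = 1 of Schur's test: by Tonelli the column condition alone suffices. -/
lemma lintegral_lintegral_le_of_schur [SFinite μ] {k : X → X → ℝ≥0∞}
    (hk : Measurable (Function.uncurry k)) {D : ℝ≥0∞}
    (h2 : ∀ᵐ w ∂μ, ∫⁻ z, k z w ∂μ ≤ D) {F : X → ℝ≥0∞} (hF : Measurable F) :
    ∫⁻ z, ∫⁻ w, k z w * F w ∂μ ∂μ ≤ D * ∫⁻ w, F w ∂μ := by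
  have hk' : Measurable fun x : X × X => k x.1 x.2 := hk
  rw [lintegral_lintegral_swap (Measurable.aemeasurable (by
    simp only [Function.uncurry_def]; fun_prop)), ← lintegral_const_mul _ hF]
  refine lintegral_mono_ae ?_
  filter_upwards [h2] with w hw
  have hkw : Measurable fun z => k z w := hk'.comp measurable_prodMk_right
  rw [lintegral_mul_const _ hkw]
  gcongr

/-- An inequality between nonnegative integrals gives all three clauses of boundedness at once:
finiteness of the left side forces absolute convergence almost everywhere. A measurable
representative g replaces f, which is only almost everywhere strongly measurable. -/
lemma isBoundedOnLp_of_lintegral_le [SFinite μ] {k : X → X → ℂ}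
    (hk : Measurable (Function.uncurry k)) {p : ℝ} (hp : 0 < p) {C : ℝ≥0∞} (hC : C ≠ ∞)
    (h : ∀ F : X → ℝ≥0∞, Measurable F →
      ∫⁻ z, (∫⁻ w, ‖k z w‖ₑ * F w ∂μ) ^ p ∂μ ≤ C * ∫⁻ w, F w ^ p ∂μ) :
    IsBoundedOnLp k μ μ (ENNReal.ofReal p) := by
  have hk' : Measurable fun x : X × X => k x.1 x.2 := hk
  have hk1 : ∀ z, Measurable (k z) := fun z => hk.comp measurable_prodMk_left
  have hp0 : ENNReal.ofReal p ≠ 0 := by simpa using hp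
  have hnorm : ∀ g : X → ℂ, eLpNorm g (ENNReal.ofReal p) μ =
      (∫⁻ x, ‖g x‖ₑ ^ p ∂μ) ^ (1 / p) := fun g => by
    rw [eLpNorm_eq_lintegral_rpow_enorm_toReal hp0 ENNReal.ofReal_ne_top,
      ENNReal.toReal_ofReal hp.le]
  have hCp : C ^ (1 / p) ≠ ∞ := ENNReal.rpow_ne_top_of_nonneg (by positivity) hC
  refine ⟨(C ^ (1 / p)).toNNReal, fun f hf => ?_⟩
  rw [ENNReal.coe_toNNReal hCp]
  obtain ⟨g, hg, hfg⟩ := hf.1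
  have hgm := hg.measurable
  have hFm : Measurable fun w => ‖g w‖ₑ := hgm.enorm
  have hfg' : ∀ z, ∫⁻ w, ‖f w * k z w‖ₑ ∂μ = ∫⁻ w, ‖k z w‖ₑ * ‖g w‖ₑ ∂μ := fun z => by
    refine lintegral_congr_ae ?_
    filter_upwards [hfg] with w hw
    rw [hw, enorm_mul, mul_comm]
  have hgf : ∫⁻ w, ‖g w‖ₑ ^ p ∂μ = ∫⁻ w, ‖f w‖ₑ ^ p ∂μ := by
    refine lintegral_congr_ae ?_
    filter_upwards [hfg] with w hw
    rw [hw]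
  have hb := h _ hFm
  rw [hgf] at hb
  simp only [← hfg'] at hb
  have hfin : ∫⁻ w, ‖f w‖ₑ ^ p ∂μ < ∞ := by
    have := hf.2
    rw [hnorm] at this
    by_contra hcon
    rw [not_lt, top_le_iff] at hcon
    rw [hcon, ENNReal.top_rpow_of_pos (by positivity)] at this
    exact lt_irrefl _ this
  have hle : eLpNorm (integralOp k μ f) (ENNReal.ofReal p) μ ≤
      C ^ (1 / p) * eLpNorm f (ENNReal.ofReal p) μ := by
    rw [hnorm, hnorm, ← ENNReal.mul_rpow_of_nonneg _ _ (by positivity)]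
    gcongr
    refine le_trans (lintegral_mono fun z => ?_) hb
    gcongr
    exact enorm_integral_le_lintegral_enorm _
  refine ⟨?_, ⟨?_, hle.trans_lt (ENNReal.mul_lt_top hCp.lt_top hf.2)⟩, hle⟩
  · have hmeas : Measurable fun z => (∫⁻ w, ‖f w * k z w‖ₑ ∂μ) ^ p := by
      simp only [hfg']
      exact (Measurable.lintegral_prod_right' (f := fun x : X × X => ‖k x.1 x.2‖ₑ * ‖g x.2‖ₑ)
        (by fun_prop)).pow_const p
    filter_upwards [ae_lt_top hmeas (hb.trans_lt (ENNReal.mul_lt_top hC.lt_top hfin)).ne]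
      with z hz
    refine ⟨hf.1.mul (hk1 z).aestronglyMeasurable, ?_⟩
    rw [hasFiniteIntegral_iff_enorm]
    by_contra hcon
    rw [not_lt, top_le_iff] at hcon
    rw [hcon, ENNReal.top_rpow_of_pos hp] at hz
    exact lt_irrefl _ hz
  · exact AEStronglyMeasurable.integral_prod_right' (f := fun x : X × X => f x.2 * k x.1 x.2)
      (hf.1.comp_snd.mul hk'.aestronglyMeasurable)

/-- Applied to |f|, the operator with the nonnegative kernel k has no cancellation, so it dominates
the one with kernel k' applied to f. -/
lemma IsBoundedOnLp.of_norm_le [SFinite μ] {k k' : X → X → ℂ} {p : ℝ≥0∞}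
    (h : IsBoundedOnLp k μ μ p) (hk : Measurable (Function.uncurry k')) {D : ℝ}
    (hpos : ∀ᵐ z ∂μ, ∀ᵐ w ∂μ, k z w = ‖k z w‖)
    (hle : ∀ᵐ z ∂μ, ∀ᵐ w ∂μ, ‖k' z w‖ ≤ D * ‖k z w‖) : IsBoundedOnLp k' μ μ p := by
  have hk' : Measurable fun x : X × X => k' x.1 x.2 := hk
  have hk1 : ∀ z, Measurable (k' z) := fun z => hk.comp measurable_prodMk_left
  obtain ⟨C, hC⟩ := h
  refine ⟨D.toNNReal * C, fun f hf => ?_⟩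
  have hf' : MemLp (fun w => (‖f w‖ : ℂ)) p μ := hf.norm.ofReal
  obtain ⟨h1, h2, h3⟩ := hC _ hf'
  have hn : eLpNorm (fun w => (‖f w‖ : ℂ)) p μ = eLpNorm f p μ :=
    eLpNorm_congr_norm_ae (ae_of_all _ fun w => by simp)
  have hint : ∀ᵐ z ∂μ, Integrable (fun w => f w * k' z w) μ := by
    filter_upwards [h1, hle] with z hz hzle
    refine (hz.norm.const_mul D).mono' (hf.1.mul (hk1 z).aestronglyMeasurable) ?_
    filter_upwards [hzle] with w hw
    rw [norm_mul, norm_mul, Complex.norm_real, norm_norm]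
    calc ‖f w‖ * ‖k' z w‖ ≤ ‖f w‖ * (D * ‖k z w‖) := by gcongr
      _ = _ := by ring
  have hbd : ∀ᵐ z ∂μ, ‖integralOp k' μ f z‖ ≤ D * ‖integralOp k μ (fun w => (‖f w‖ : ℂ)) z‖ := by
    filter_upwards [h1, hle, hint, hpos] with z hz hzle hzint hzpos
    have e : integralOp k μ (fun w => (‖f w‖ : ℂ)) z =
        ((∫ w, ‖f w‖ * ‖k z w‖ ∂μ : ℝ) : ℂ) := by
      rw [integralOp, ← integral_complex_ofReal]
      refine integral_congr_ae ?_
      filter_upwards [hzpos] with w hw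
      rw [hw]
      push_cast
      simp
    have hz' : Integrable (fun w => ‖f w‖ * ‖k z w‖) μ := by
      refine hz.norm.congr (ae_of_all _ fun w => ?_)
      simp
    rw [e, Complex.norm_real, Real.norm_of_nonneg (integral_nonneg fun w => by positivity),
      ← integral_const_mul]
    refine (norm_integral_le_integral_norm _).trans (integral_mono_ae hzint.norm
      (hz'.const_mul D) ?_)
    filter_upwards [hzle] with w hw
    rw [norm_mul]
    calc ‖f w‖ * ‖k' z w‖ ≤ ‖f w‖ * (D * ‖k z w‖) := by gcongr
      _ = _ := by ring
  have hm : AEStronglyMeasurable (integralOp k' μ f) μ :=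
    AEStronglyMeasurable.integral_prod_right' (f := fun x : X × X => f x.2 * k' x.1 x.2)
      (hf.1.comp_snd.mul hk'.aestronglyMeasurable)
  refine ⟨hint, h2.of_le_mul hm hbd, ?_⟩
  calc _ ≤ ENNReal.ofReal D * eLpNorm (integralOp k μ (fun w => (‖f w‖ : ℂ))) p μ :=
        eLpNorm_le_mul_eLpNorm_of_ae_le_mul hbd p
    _ ≤ ENNReal.ofReal D * (C * eLpNorm f p μ) := by
        rw [← hn]
        gcongr
    _ = _ := by
        rw [← mul_assoc, ENNReal.coe_mul]
        rfl

lemma integralOp_withDensity {g : X → ℝ} (hg : Measurable g) (hg0 : ∀ᵐ w ∂μ, 0 ≤ g w)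
    (hν : ν = μ.withDensity fun w => ENNReal.ofReal (g w)) (k : X → X → ℂ) (f : X → ℂ) (z : X) :
    integralOp k ν f z = integralOp (fun z w => k z w * g w) μ f z := by
  rw [hν, integralOp, integralOp]
  have : (fun w => ENNReal.ofReal (g w)) = fun w => ((g w).toNNReal : ℝ≥0∞) := rfl
  rw [this, integral_withDensity_eq_integral_smul hg.real_toNNReal]
  refine integral_congr_ae ?_
  filter_upwards [hg0] with w hw
  simp only [NNReal.smul_def, Real.coe_toNNReal _ hw, Complex.real_smul]
  ring

/-- Lets T, defined through μ_{a,b}, be viewed as an operator over μ_{c,d} like S. -/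
lemma isBoundedOnLp_withDensity_iff {g : X → ℝ} (hg : Measurable g) (hg0 : ∀ᵐ w ∂μ, 0 ≤ g w)
    (hν : ν = μ.withDensity fun w => ENNReal.ofReal (g w)) (k : X → X → ℂ) (p : ℝ≥0∞)
    (μ' : Measure X) :
    IsBoundedOnLp k ν μ' p ↔ IsBoundedOnLp (fun z w => k z w * g w) μ μ' p := by
  have h1 : ∀ f, integralOp k ν f = integralOp (fun z w => k z w * g w) μ f := fun f =>
    funext fun z => integralOp_withDensity hg hg0 hν k f z
  have h2 : ∀ (f : X → ℂ) z, Integrable (fun w => f w * k z w) ν ↔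
      Integrable (fun w => f w * (k z w * g w)) μ := by
    intro f z
    rw [hν, integrable_withDensity_iff_integrable_smul' hg.ennreal_ofReal
      (ae_of_all _ fun w => ENNReal.ofReal_lt_top)]
    refine integrable_congr ?_
    filter_upwards [hg0] with w hw
    simp only [ENNReal.toReal_ofReal hw, Complex.real_smul]
    ring
  simp only [IsBoundedOnLp, h1, h2]

end Operators

/-! ### Power weights on the ball -/

/-- The function `(1 - |w|²)^x |w|^{2y}` on `ℂⁿ`. -/
def ballWeight {n : ℕ} (x y : ℝ) (w : Cn n) : ℝ := (1 - ‖w‖ ^ 2) ^ x * ‖w‖ ^ (2 * y)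

section BallWeight

variable {n : ℕ} {a b c d x y x' y' : ℝ} {w : Cn n}

@[fun_prop]
lemma measurable_ballWeight : Measurable (ballWeight (n := n) x y) := by
  unfold ballWeight
  fun_prop

lemma one_sub_norm_sq_pos (hw : ‖w‖ < 1) : 0 < 1 - ‖w‖ ^ 2 :=
  sub_pos.2 ((sq_lt_one_iff₀ (norm_nonneg _)).2 hw)

lemma ballWeight_nonneg (hw : ‖w‖ < 1) : 0 ≤ ballWeight x y w :=
  mul_nonneg (Real.rpow_nonneg (one_sub_norm_sq_pos hw).le _) (Real.rpow_nonneg (norm_nonneg _) _)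

lemma ballWeight_pos (hw : ‖w‖ < 1) (h0 : w ≠ 0) : 0 < ballWeight x y w :=
  mul_pos (Real.rpow_pos_of_pos (one_sub_norm_sq_pos hw) _)
    (Real.rpow_pos_of_pos (norm_pos_iff.2 h0) _)

lemma ballWeight_mul (hw : ‖w‖ < 1) (h0 : w ≠ 0) :
    ballWeight x y w * ballWeight x' y' w = ballWeight (x + x') (y + y') w := by
  rw [ballWeight, ballWeight, ballWeight, mul_add, Real.rpow_add (one_sub_norm_sq_pos hw),
    Real.rpow_add (norm_pos_iff.2 h0)]
  ring

lemma ballWeight_rpow (hw : ‖w‖ < 1) (p : ℝ) :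
    ballWeight x y w ^ p = ballWeight (p * x) (p * y) w := by
  have h1 := one_sub_norm_sq_pos hw
  rw [ballWeight, ballWeight, Real.mul_rpow (by positivity) (by positivity),
    ← Real.rpow_mul h1.le, ← Real.rpow_mul (norm_nonneg _)]
  congr 2 <;> ring

/-- The density of `mu n a b` with respect to `mu n c d`. -/
lemma mu_eq_withDensity (i : Fin n) (ha : -1 < a) (hb : -(n : ℝ) < b) (hc : -1 < c)
    (hd : -(n : ℝ) < d) : mu n a b = (mu n c d).withDensity fun w =>
      ENNReal.ofReal (ProbabilityTheory.beta (c + 1) (d + n) /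
        ProbabilityTheory.beta (a + 1) (b + n) * ballWeight (a - c) (b - d) w) := by
  have : Nontrivial (Cn n) := by
    have := i.pos
    apply Module.nontrivial_of_finrank_pos (R := ℝ)
    rw [finrank_Cn]
    omega
  have hA := ProbabilityTheory.beta_pos (by linarith : 0 < a + 1) (by linarith : 0 < b + n)
  have hC := ProbabilityTheory.beta_pos (by linarith : 0 < c + 1) (by linarith : 0 < d + n)
  rw [mu, mu, ← withDensity_mul _ (by fun_prop) (by fun_prop)]
  refine withDensity_congr_ae ?_
  filter_upwards [ae_restrict_mem Metric.isOpen_ball.measurableSet,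
    ae_restrict_of_ae (Measure.ae_ne volume (0 : Cn n))] with w hw hw0
  have hw1 : ‖w‖ < 1 := by simpa using hw
  have h1 := one_sub_norm_sq_pos hw1
  have h0 := norm_pos_iff.2 hw0
  rw [Pi.mul_apply, ← ENNReal.ofReal_mul (by positivity), ballWeight]
  congr 1
  have e1 : (1 - ‖w‖ ^ 2) ^ a = (1 - ‖w‖ ^ 2) ^ c * (1 - ‖w‖ ^ 2) ^ (a - c) := by
    rw [← Real.rpow_add h1]
    ring_nf
  have e2 : ‖w‖ ^ (2 * b) = ‖w‖ ^ (2 * d) * ‖w‖ ^ (2 * (b - d)) := by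
    rw [← Real.rpow_add h0]
    ring_nf
  rw [e1, e2]
  field_simp

lemma exists_lintegral_ballWeight_mul (i : Fin n) (hc : -1 < c) (hd : -(n : ℝ) < d)
    (hx : -1 < c + x) (hy : -(n : ℝ) < d + y) : ∃ A : ℝ, 0 < A ∧ ∀ F : Cn n → ℝ≥0∞,
      ∫⁻ w, ENNReal.ofReal (ballWeight x y w) * F w ∂(mu n c d) =
        ENNReal.ofReal A * ∫⁻ w, F w ∂(mu n (c + x) (d + y)) := by
  have hA := ProbabilityTheory.beta_pos (by linarith : 0 < c + x + 1)
    (by linarith : 0 < d + y + n)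
  have hC := ProbabilityTheory.beta_pos (by linarith : 0 < c + 1) (by linarith : 0 < d + n)
  refine ⟨ProbabilityTheory.beta (c + x + 1) (d + y + n) / ProbabilityTheory.beta (c + 1) (d + n),
    by positivity, fun F => ?_⟩
  rw [mu_eq_withDensity i hx hy hc hd, lintegral_withDensity_eq_lintegral_mul_non_measurable _
    (by fun_prop) (ae_of_all _ fun w => ENNReal.ofReal_lt_top),
    ← lintegral_const_mul' _ _ ENNReal.ofReal_ne_top]
  refine lintegral_congr fun w => ?_
  rw [Pi.mul_apply, ← mul_assoc, ← ENNReal.ofReal_mul (by positivity), add_sub_cancel_left,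
    add_sub_cancel_left]
  congr 2
  field_simp

/-- The weight is absorbed into the measure, which becomes μ_{c+x,d+y} up to a constant. The
exponent s depends on x and γ but not on y. -/
lemma exists_lintegral_ballWeight_mul_one_sub_herm_le (i : Fin n) (hc : -1 < c)
    (hd : -(n : ℝ) < d) (hx : -1 < c + x) (hy : -(n : ℝ) < d + y) {s γ : ℝ} (hs : 0 < s)
    (hγ : γ = n + 1 + (c + x) + s) : ∃ C : ℝ, 0 < C ∧ ∀ z : Cn n, ‖z‖ < 1 →
      ∫⁻ w, ENNReal.ofReal (ballWeight x y w) * ENNReal.ofReal (‖1 - herm z w‖ ^ (-γ))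
        ∂(mu n c d) ≤ ENNReal.ofReal (C * (1 - ‖z‖ ^ 2) ^ (-s)) := by
  obtain ⟨A, hA, h⟩ := exists_lintegral_ballWeight_mul i hc hd hx hy
  obtain ⟨C, hC, hFR⟩ := exists_lintegral_one_sub_herm_le i hx hy hs
  refine ⟨A * C, by positivity, fun z hz => ?_⟩
  rw [h, mul_assoc, ENNReal.ofReal_mul hA.le, hγ]
  gcongr
  exact hFR z hz

end BallWeight

/-! ### The kernels of T and S over the same measure -/

section Kernels

variable {n : ℕ} {a b c d : ℝ}

lemma measurable_ordinaryHypergeometric (A B C : ℝ) :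
    Measurable fun ξ : ℂ => ordinaryHypergeometric A B C ξ := by
  simp only [ordinaryHypergeometric_eq_tsum_hypCoeff]
  exact Measurable.tsum fun k => by fun_prop

@[fun_prop]
lemma measurable_K : Measurable (K n a b) := measurable_ordinaryHypergeometric _ _ _

@[fun_prop]
lemma measurable_Q : Measurable (Q n a b) := measurable_ordinaryHypergeometric _ _ _

lemma kerS_eq (z w : Cn n) : kerS n a b c d z w = ((‖Q n a b (herm z w)‖ *
    ‖1 - herm z w‖ ^ (-(a + n + 1)) * ballWeight (a - c) (b - d) w : ℝ) : ℂ) := by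
  rw [kerS, ballWeight, Real.rpow_neg (norm_nonneg _), ← div_eq_mul_inv, mul_sub 2 b d]

lemma measurable_kerT : Measurable (Function.uncurry (kerT n a b)) := by
  simp only [Function.uncurry_def, kerT]
  fun_prop

lemma measurable_kerS : Measurable (Function.uncurry (kerS n a b c d)) := by
  simp only [Function.uncurry_def, kerS_eq]
  fun_prop

lemma norm_herm_lt_one {z w : Cn n} (hz : ‖z‖ < 1) (hw : ‖w‖ < 1) : ‖herm z w‖ < 1 :=
  (norm_herm_le z w).trans_lt (mul_lt_one_of_nonneg_of_lt_one_left (norm_nonneg _) hz hw.le)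

lemma ae_ballWeight_nonneg (r : ℝ) (hr : 0 ≤ r) (x y : ℝ) :
    ∀ᵐ w ∂(mu n c d), 0 ≤ r * ballWeight x y w := by
  filter_upwards [ae_mu_norm_lt_one] with w hw
  exact mul_nonneg hr (ballWeight_nonneg hw)

lemma T_eq (i : Fin n) (ha : -1 < a) (hb : -(n : ℝ) < b) (hc : -1 < c)
    (hd : -(n : ℝ) < d) (f : Cn n → ℂ) {z : Cn n} (hz : ‖z‖ < 1) :
    T n a b f z = ((ProbabilityTheory.beta (c + 1) (d + n) /
        ProbabilityTheory.beta (a + 1) (b + n) : ℝ) : ℂ) *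
      ∫ w, f w * Q n a b (herm z w) / (1 - herm z w) ^ ((a + n + 1 : ℝ) : ℂ) *
        (((1 - ‖w‖ ^ 2) ^ (a - c) * ‖w‖ ^ (2 * b - 2 * d) : ℝ) : ℂ) ∂(mu n c d) := by
  have hA := ProbabilityTheory.beta_pos (by linarith : 0 < a + 1) (by linarith : 0 < b + n)
  have hC := ProbabilityTheory.beta_pos (by linarith : 0 < c + 1) (by linarith : 0 < d + n)
  rw [T, integralOp_withDensity (by fun_prop) (ae_ballWeight_nonneg _ (by positivity) _ _)
    (mu_eq_withDensity i ha hb hc hd), integralOp, ← integral_const_mul]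
  refine integral_congr_ae ?_
  filter_upwards [ae_mu_norm_lt_one] with w hw
  rw [kerT, K_eq_div hb (norm_herm_lt_one hz hw), ballWeight, mul_sub 2 b d]
  push_cast
  ring

/-- Over μ_{c,d}, the modulus of the kernel of T is the kernel of S times a quotient of Beta values.
-/
lemma kerT_bounded_of_kerS_bounded (i : Fin n) (ha : -1 < a) (hb : -(n : ℝ) < b) (hc : -1 < c)
    (hd : -(n : ℝ) < d) {p : ℝ≥0∞}
    (h : IsBoundedOnLp (kerS n a b c d) (mu n c d) (mu n c d) p) :
    IsBoundedOnLp (kerT n a b) (mu n a b) (mu n c d) p := by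
  have := isFiniteMeasure_mu hc hd i
  have hA := ProbabilityTheory.beta_pos (by linarith : 0 < a + 1) (by linarith : 0 < b + n)
  have hC := ProbabilityTheory.beta_pos (by linarith : 0 < c + 1) (by linarith : 0 < d + n)
  rw [isBoundedOnLp_withDensity_iff (by fun_prop) (ae_ballWeight_nonneg _ (by positivity) _ _)
    (mu_eq_withDensity i ha hb hc hd)]
  refine h.of_norm_le (D := ProbabilityTheory.beta (c + 1) (d + n) /
    ProbabilityTheory.beta (a + 1) (b + n)) ?_ ?_ ?_
  · have hT : Measurable fun x : Cn n × Cn n => kerT n a b x.1 x.2 := measurable_kerT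
    simp only [Function.uncurry_def]
    fun_prop
  · filter_upwards [ae_mu_norm_lt_one] with z hz
    filter_upwards [ae_mu_norm_lt_one] with w hw
    rw [kerS_eq, Complex.norm_real, Real.norm_of_nonneg]
    exact mul_nonneg (by positivity) (ballWeight_nonneg hw)
  · filter_upwards [ae_mu_norm_lt_one] with z hz
    filter_upwards [ae_mu_norm_lt_one] with w hw
    have hW := ballWeight_nonneg (x := a - c) (y := b - d) hw
    rw [kerS_eq, Complex.norm_real, Real.norm_of_nonneg (mul_nonneg (by positivity) hW), norm_mul,
      Complex.norm_real, Real.norm_of_nonneg (mul_nonneg (by positivity) hW), kerT,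
      norm_K hb (norm_herm_lt_one hz hw), Real.rpow_neg (norm_nonneg _)]
    apply le_of_eq
    ring

end Kernels

/-! ### Sufficiency of the exponent conditions -/

section Sufficiency

variable {n : ℕ} {a b c d p : ℝ}

lemma norm_one_sub_herm_comm (z w : Cn n) : ‖1 - herm z w‖ = ‖1 - herm w z‖ := by
  rw [← RCLike.norm_conj (1 - herm z w), map_sub, map_one, herm_eq_inner, herm_eq_inner,
    inner_conj_symm]

/-- It suffices to bound the positive operator with kernel
`|1 - ⟨z, w⟩|^{-(a+n+1)} (1 - |w|²)^{a-c} |w|^{2(b-d)}`. -/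
lemma kerS_bounded_of_lintegral_le (i : Fin n) (ha : -1 < a) (hb : -(n : ℝ) < b) (hc : -1 < c)
    (hd : -(n : ℝ) < d) (hp : 0 < p) {C : ℝ≥0∞} (hC : C ≠ ∞)
    (h : ∀ F : Cn n → ℝ≥0∞, Measurable F →
      ∫⁻ z, (∫⁻ w, ENNReal.ofReal (‖1 - herm z w‖ ^ (-(a + n + 1))) *
        ENNReal.ofReal (ballWeight (a - c) (b - d) w) * F w ∂(mu n c d)) ^ p ∂(mu n c d) ≤
          C * ∫⁻ w, F w ^ p ∂(mu n c d)) :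
    IsBoundedOnLp (kerS n a b c d) (mu n c d) (mu n c d) (ENNReal.ofReal p) := by
  have := isFiniteMeasure_mu hc hd i
  obtain ⟨M, hM, hQ⟩ := exists_norm_Q_le ha hb
  refine isBoundedOnLp_of_lintegral_le measurable_kerS hp (C := ENNReal.ofReal M ^ p * C)
    (ENNReal.mul_ne_top (ENNReal.rpow_ne_top_of_nonneg hp.le ENNReal.ofReal_ne_top) hC)
    fun F hF => ?_
  have hle : ∀ᵐ z ∂(mu n c d), (∫⁻ w, ‖kerS n a b c d z w‖ₑ * F w ∂(mu n c d)) ^ p ≤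
      ENNReal.ofReal M ^ p * (∫⁻ w, ENNReal.ofReal (‖1 - herm z w‖ ^ (-(a + n + 1))) *
        ENNReal.ofReal (ballWeight (a - c) (b - d) w) * F w ∂(mu n c d)) ^ p := by
    filter_upwards [ae_mu_norm_lt_one] with z hz
    rw [← ENNReal.mul_rpow_of_nonneg _ _ hp.le, ← lintegral_const_mul' _ _ ENNReal.ofReal_ne_top]
    gcongr ?_ ^ p
    refine lintegral_mono_ae ?_
    filter_upwards [ae_mu_norm_lt_one] with w hw
    have hW := ballWeight_nonneg (x := a - c) (y := b - d) hw
    rw [← mul_assoc, ← ENNReal.ofReal_mul (by positivity), ← ENNReal.ofReal_mul hM.le,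
      ← ofReal_norm, kerS_eq, Complex.norm_real,
      Real.norm_of_nonneg (mul_nonneg (by positivity) hW), mul_assoc]
    gcongr
    exact hQ _ (norm_herm_lt_one hz hw).le
  calc _ ≤ _ := lintegral_mono_ae hle
    _ = ENNReal.ofReal M ^ p * ∫⁻ z, (∫⁻ w, ENNReal.ofReal (‖1 - herm z w‖ ^ (-(a + n + 1))) *
        ENNReal.ofReal (ballWeight (a - c) (b - d) w) * F w ∂(mu n c d)) ^ p ∂(mu n c d) :=
        lintegral_const_mul' _ _ (ENNReal.rpow_ne_top_of_nonneg hp.le ENNReal.ofReal_ne_top)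
    _ ≤ _ := by
        rw [mul_assoc]
        gcongr
        exact h F hF

lemma measurable_positive_kernel (γ x y : ℝ) : Measurable (Function.uncurry fun z w : Cn n =>
    ENNReal.ofReal (‖1 - herm z w‖ ^ (-γ)) * ENNReal.ofReal (ballWeight x y w)) := by
  simp only [Function.uncurry_def]
  fun_prop

/-- Forelli-Rudin with s = a - c > 0 bounds each column integral by (1-|w|²)^{-(a-c)}, which the
weight cancels. The remaining |w|^{2(b-d)} is at most 1 since d ≤ b. -/
lemma kerS_bounded_one (i : Fin n) (ha : -1 < a) (hb : -(n : ℝ) < b) (hc : -1 < c)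
    (hd : -(n : ℝ) < d) (hca : c < a) (hdb : d ≤ b) :
    IsBoundedOnLp (kerS n a b c d) (mu n c d) (mu n c d) (ENNReal.ofReal 1) := by
  have := isFiniteMeasure_mu hc hd i
  obtain ⟨C, hC, hFR⟩ := exists_lintegral_one_sub_herm_le i hc hd (sub_pos.2 hca)
  refine kerS_bounded_of_lintegral_le i ha hb hc hd one_pos (C := ENNReal.ofReal C)
    ENNReal.ofReal_ne_top fun F hF => ?_
  simp only [ENNReal.rpow_one]
  refine lintegral_lintegral_le_of_schur (measurable_positive_kernel _ _ _) ?_ hF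
  filter_upwards [ae_mu_norm_lt_one, ae_mu_ne_zero i] with w hw hw0
  have h1 := one_sub_norm_sq_pos hw
  have h0 := norm_pos_iff.2 hw0
  have e : (n : ℝ) + 1 + c + (a - c) = a + n + 1 := by ring
  rw [lintegral_mul_const' _ _ ENNReal.ofReal_ne_top]
  simp only [fun z => norm_one_sub_herm_comm z w]
  have := hFR w hw
  rw [e] at this
  calc _ ≤ ENNReal.ofReal (C * (1 - ‖w‖ ^ 2) ^ (-(a - c))) *
        ENNReal.ofReal (ballWeight (a - c) (b - d) w) := by gcongr
    _ ≤ ENNReal.ofReal C := by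
        rw [← ENNReal.ofReal_mul (by positivity)]
        refine ENNReal.ofReal_le_ofReal ?_
        have e2 : (1 - ‖w‖ ^ 2) ^ (-(a - c)) * (1 - ‖w‖ ^ 2) ^ (a - c) = 1 := by
          rw [← Real.rpow_add h1, neg_add_cancel, Real.rpow_zero]
        rw [ballWeight, mul_assoc, ← mul_assoc ((1 - ‖w‖ ^ 2) ^ (-(a - c))), e2, one_mul]
        exact mul_le_of_le_one_right hC.le
          (Real.rpow_le_one h0.le hw.le (by linarith))

/-- Schur's test with h = (1-|w|²)^{-α} |w|^{-2β}. -/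
lemma kerS_bounded_of_one_lt (i : Fin n) (ha : -1 < a) (hb : -(n : ℝ) < b) (hc : -1 < c)
    (hd : -(n : ℝ) < d) (hp : 1 < p) (hac : c + 1 < p * (a + 1))
    (hbd : d + n < p * (b + n)) :
    IsBoundedOnLp (kerS n a b c d) (mu n c d) (mu n c d) (ENNReal.ofReal p) := by
  have := isFiniteMeasure_mu hc hd i
  have hp0 : 0 < p := by linarith
  obtain ⟨q, hpq⟩ : ∃ q, p.HolderConjugate q := ⟨_, Real.HolderConjugate.conjExponent hp⟩
  have hq0 := hpq.symm.pos
  have hpq1 : q * (p - 1) = p := by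
    rw [mul_comm]
    exact hpq.sub_one_mul_conj
  have hinv : 1 / q = (p - 1) / p := by
    rw [div_eq_div_iff hq0.ne' hp0.ne', mul_comm (p - 1)]
    linarith
  -- The upper bounds (a+1)/q and (c+1)/p make the two Schur integrands integrable at the sphere;
  -- the lower bounds make the Forelli-Rudin exponents qα and a - c + pα positive. That (c-a)/p <
  -- (a+1)/q is exactly c + 1 < p(a+1).
  obtain ⟨α, hα1, hα2⟩ : ∃ α, max 0 ((c - a) / p) < α ∧
      α < min ((a + 1) * ((p - 1) / p)) ((c + 1) / p) := by
    refine exists_between (max_lt (lt_min ?_ ?_) (lt_min ?_ ?_))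
    · exact mul_pos (by linarith) (div_pos (by linarith) hp0)
    · exact div_pos (by linarith) hp0
    · rw [← mul_div_assoc, div_lt_div_iff_of_pos_right hp0]
      linarith
    · rw [div_lt_div_iff_of_pos_right hp0]
      linarith
  obtain ⟨hα0, hαa⟩ := max_lt_iff.1 hα1
  obtain ⟨hαq, hαp⟩ := lt_min_iff.1 hα2
  -- The upper bounds give integrability at the origin. The lower ones may be weak: they serve only
  -- |z|^{-2qβ} ≥ 1 and |w|^{2(b-d)} ≤ |w|^{-2pβ}. That (d-b)/p < (b+n)/q is exactly d + n < p(b+n).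
  obtain ⟨β, hβ0, hβ1, hβq, hβp⟩ : ∃ β, 0 ≤ β ∧ (d - b) / p ≤ β ∧
      β < (b + n) * ((p - 1) / p) ∧ β < (d + n) / p := by
    refine ⟨max 0 ((d - b) / p), le_max_left _ _, le_max_right _ _, max_lt ?_ ?_, max_lt ?_ ?_⟩
    · exact mul_pos (by linarith) (div_pos (by linarith) hp0)
    · rw [← mul_div_assoc, div_lt_div_iff_of_pos_right hp0]
      linarith
    · exact div_pos (by linarith) hp0
    · rw [div_lt_div_iff_of_pos_right hp0]
      linarith
  rw [← hinv, mul_one_div, lt_div_iff₀ hq0] at hαq hβq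
  rw [lt_div_iff₀ hp0] at hαp hβp
  rw [div_lt_iff₀ hp0] at hαa
  rw [div_le_iff₀ hp0] at hβ1
  have hqα : 0 < q * α := by positivity
  have hqβ : 0 ≤ q * β := by positivity
  obtain ⟨C, hC, hC'⟩ := exists_lintegral_ballWeight_mul_one_sub_herm_le i hc hd
    (x := a - c - q * α) (y := b - d - q * β) (by linarith) (by linarith) (s := q * α)
    (γ := a + n + 1) hqα (by ring)
  obtain ⟨D, hD, hD'⟩ := exists_lintegral_ballWeight_mul_one_sub_herm_le i hc hd
    (x := p * (-α)) (y := p * (-β)) (by linarith) (by linarith) (s := a - c + p * α)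
    (γ := a + n + 1) (by linarith) (by ring)
  have hh : Measurable fun w : Cn n => ENNReal.ofReal (ballWeight (-α) (-β) w) := by fun_prop
  refine kerS_bounded_of_lintegral_le i ha hb hc hd hp0
    (C := ENNReal.ofReal C ^ (p / q) * ENNReal.ofReal D)
    (ENNReal.mul_ne_top (ENNReal.rpow_ne_top_of_nonneg (by positivity) ENNReal.ofReal_ne_top)
      ENNReal.ofReal_ne_top) fun F hF =>
    lintegral_rpow_le_of_schur (measurable_positive_kernel _ _ _) hh ?_ hpq ?_ ?_ hF
  · filter_upwards [ae_mu_norm_lt_one, ae_mu_ne_zero i] with w hw hw0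
    exact ⟨by simpa using ballWeight_pos hw hw0, ENNReal.ofReal_ne_top⟩
  · filter_upwards [ae_mu_norm_lt_one, ae_mu_ne_zero i] with z hz hz0
    have h1 := one_sub_norm_sq_pos hz
    have h0 := norm_pos_iff.2 hz0
    calc _ = ∫⁻ w, ENNReal.ofReal (ballWeight (a - c - q * α) (b - d - q * β) w) *
          ENNReal.ofReal (‖1 - herm z w‖ ^ (-(a + n + 1))) ∂(mu n c d) := by
          refine lintegral_congr_ae ?_
          filter_upwards [ae_mu_norm_lt_one, ae_mu_ne_zero i] with w hw hw0
          rw [ENNReal.ofReal_rpow_of_nonneg (ballWeight_nonneg hw) hq0.le, ballWeight_rpow hw,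
            mul_assoc, ← ENNReal.ofReal_mul (ballWeight_nonneg hw), ballWeight_mul hw hw0, mul_comm]
          congr 3 <;> ring
      _ ≤ ENNReal.ofReal (C * (1 - ‖z‖ ^ 2) ^ (-(q * α))) := hC' z hz
      _ ≤ _ := by
          rw [ENNReal.ofReal_rpow_of_nonneg (ballWeight_nonneg hz) hq0.le, ballWeight_rpow hz,
            ← ENNReal.ofReal_mul hC.le]
          refine ENNReal.ofReal_le_ofReal (mul_le_mul_of_nonneg_left ?_ hC.le)
          rw [ballWeight, mul_neg]
          refine le_mul_of_one_le_right (by positivity) ?_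
          exact Real.one_le_rpow_of_pos_of_le_one_of_nonpos h0 hz.le (by linarith)
  · filter_upwards [ae_mu_norm_lt_one, ae_mu_ne_zero i] with w hw hw0
    have h1 := one_sub_norm_sq_pos hw
    have h0 := norm_pos_iff.2 hw0
    calc _ = ENNReal.ofReal (ballWeight (a - c) (b - d) w) *
          ∫⁻ z, ENNReal.ofReal (ballWeight (p * (-α)) (p * (-β)) z) *
          ENNReal.ofReal (‖1 - herm w z‖ ^ (-(a + n + 1))) ∂(mu n c d) := by
          rw [← lintegral_const_mul' _ _ ENNReal.ofReal_ne_top]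
          refine lintegral_congr_ae ?_
          filter_upwards [ae_mu_norm_lt_one] with z hz
          rw [ENNReal.ofReal_rpow_of_nonneg (ballWeight_nonneg hz) hp0.le, ballWeight_rpow hz,
            norm_one_sub_herm_comm z w]
          ring
      _ ≤ ENNReal.ofReal (ballWeight (a - c) (b - d) w) *
          ENNReal.ofReal (D * (1 - ‖w‖ ^ 2) ^ (-(a - c + p * α))) := by
          gcongr
          exact hD' w hw
      _ ≤ _ := by
          rw [ENNReal.ofReal_rpow_of_nonneg (ballWeight_nonneg hw) hp0.le, ballWeight_rpow hw,
            ← ENNReal.ofReal_mul hD.le, ← ENNReal.ofReal_mul (ballWeight_nonneg hw)]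
          refine ENNReal.ofReal_le_ofReal ?_
          have e : (1 - ‖w‖ ^ 2) ^ (a - c) * (1 - ‖w‖ ^ 2) ^ (-(a - c + p * α)) =
              (1 - ‖w‖ ^ 2) ^ (p * -α) := by
            rw [← Real.rpow_add h1]
            ring_nf
          calc ballWeight (a - c) (b - d) w * (D * (1 - ‖w‖ ^ 2) ^ (-(a - c + p * α))) =
              D * ((1 - ‖w‖ ^ 2) ^ (p * -α) * ‖w‖ ^ (2 * (b - d))) := by
                rw [← e, ballWeight]
                ring
            _ ≤ D * ((1 - ‖w‖ ^ 2) ^ (p * -α) * ‖w‖ ^ (2 * (p * -β))) := by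
                gcongr _ * (_ * ?_)
                exact Real.rpow_le_rpow_of_exponent_ge h0 hw.le (by linarith)

end Sufficiency

/-! ### Exponents forced by integrability -/

section Integrability

/-- On (0, 1/2) the factor (1-x)^t is at least 2^{-|t|}, so x^s is integrable near 0. -/
lemma neg_one_lt_of_lintegral_rpow_mul_lt_top {s t : ℝ}
    (h : ∫⁻ x in Ioo (0 : ℝ) 1, ENNReal.ofReal (x ^ s * (1 - x) ^ t) < ∞) : -1 < s := by
  have hm : ∀ x ∈ Ioo (0 : ℝ) (1 / 2), x ^ s ≤ 2 ^ |t| * (x ^ s * (1 - x) ^ t) := by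
    intro x hx
    have hx0 : 0 < x := hx.1
    have hx1 : 1 / 2 < 1 - x := by linarith [hx.2]
    have h1 : ((2 : ℝ) ^ |t|)⁻¹ ≤ (1 - x) ^ t := by
      calc ((2 : ℝ) ^ |t|)⁻¹ = (1 / 2 : ℝ) ^ |t| := by
            rw [one_div, Real.inv_rpow (by norm_num)]
        _ ≤ (1 - x) ^ |t| := Real.rpow_le_rpow (by norm_num) hx1.le (abs_nonneg _)
        _ ≤ (1 - x) ^ t := Real.rpow_le_rpow_of_exponent_ge (by linarith) (by linarith)
            (le_abs_self t)
    calc x ^ s = 2 ^ |t| * (x ^ s * ((2 : ℝ) ^ |t|)⁻¹) := by field_simp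
      _ ≤ _ := by gcongr
  rw [← intervalIntegral.integrableOn_Ioo_rpow_iff (t := 1 / 2) (by norm_num)]
  refine ⟨by fun_prop, ?_⟩
  rw [hasFiniteIntegral_iff_ofReal]
  · calc _ ≤ ∫⁻ x in Ioo (0 : ℝ) (1 / 2),
          ENNReal.ofReal (2 ^ |t|) * ENNReal.ofReal (x ^ s * (1 - x) ^ t) := by
          refine setLIntegral_mono' measurableSet_Ioo fun x hx => ?_
          rw [← ENNReal.ofReal_mul (by positivity)]
          exact ENNReal.ofReal_le_ofReal (hm x hx)
      _ = ENNReal.ofReal (2 ^ |t|) * ∫⁻ x in Ioo (0 : ℝ) (1 / 2),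
          ENNReal.ofReal (x ^ s * (1 - x) ^ t) := lintegral_const_mul' _ _ ENNReal.ofReal_ne_top
      _ ≤ ENNReal.ofReal (2 ^ |t|) * ∫⁻ x in Ioo (0 : ℝ) 1,
          ENNReal.ofReal (x ^ s * (1 - x) ^ t) := by
          refine mul_le_mul_right (lintegral_mono_set ?_) _
          exact Ioo_subset_Ioo le_rfl (by norm_num : (1 / 2 : ℝ) ≤ 1)
      _ < ∞ := ENNReal.mul_lt_top ENNReal.ofReal_lt_top h
  · filter_upwards [ae_restrict_mem measurableSet_Ioo] with x hx
    exact Real.rpow_nonneg hx.1.le _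

lemma lintegral_Ioo_one_sub (g : ℝ → ℝ≥0∞) :
    ∫⁻ x in Ioo (0 : ℝ) 1, g (1 - x) = ∫⁻ x in Ioo (0 : ℝ) 1, g x := by
  rw [← lintegral_indicator measurableSet_Ioo, ← lintegral_indicator measurableSet_Ioo,
    ← lintegral_sub_left_eq_self ((Ioo (0 : ℝ) 1).indicator g) 1]
  refine lintegral_congr fun x => ?_
  by_cases hx : x ∈ Ioo (0 : ℝ) 1
  · rw [indicator_of_mem hx, indicator_of_mem]
    exact ⟨by linarith [hx.2], by linarith [hx.1]⟩
  · rw [indicator_of_notMem hx, indicator_of_notMem]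
    exact fun h => hx ⟨by linarith [h.2], by linarith [h.1]⟩

lemma exponents_of_lintegral_lt_top {s t : ℝ}
    (h : ∫⁻ x in Ioo (0 : ℝ) 1, ENNReal.ofReal (x ^ s * (1 - x) ^ t) < ∞) : -1 < s ∧ -1 < t := by
  refine ⟨neg_one_lt_of_lintegral_rpow_mul_lt_top h,
    neg_one_lt_of_lintegral_rpow_mul_lt_top (t := s) ?_⟩
  rw [← lintegral_Ioo_one_sub] at h
  simpa only [sub_sub_cancel, mul_comm] using h

variable {n : ℕ} {c d x y : ℝ}

lemma exponents_of_lintegral_ballWeight_lt_top (i : Fin n) (hc : -1 < c) (hd : -(n : ℝ) < d)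
    (h : ∫⁻ w, ENNReal.ofReal (ballWeight x y w) ∂(mu n c d) < ∞) :
    -1 < c + x ∧ -(n : ℝ) < d + y := by
  have : Nontrivial (Cn n) := by
    have := i.pos
    apply Module.nontrivial_of_finrank_pos (R := ℝ)
    rw [finrank_Cn]
    omega
  rw [lintegral_mu hc hd] at h
  have hM : ENNReal.ofReal (muConst n c d) ≠ 0 := by simpa using muConst_pos hc hd
  have h1 := ENNReal.lt_top_of_mul_ne_top_right h.ne hM
  -- The trivial factor with exponent 2 * 0 gives the integral the shape of `exists_lintegral_coord`
  -- at k = 0.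
  have e : ∫⁻ w : Cn n, radialWeight c d (‖w‖ ^ 2) * ENNReal.ofReal (ballWeight x y w) =
      ∫⁻ w : Cn n, ENNReal.ofReal (‖w i‖ ^ (2 * 0)) *
        radialWeight (c + x) (d + y) (‖w‖ ^ 2) := by
    refine lintegral_congr_ae ?_
    filter_upwards [Measure.ae_ne volume (0 : Cn n)] with w hw0
    rw [mul_zero, pow_zero, ENNReal.ofReal_one, one_mul, radialWeight, radialWeight]
    by_cases hw : ‖w‖ ^ 2 ∈ Iio (1 : ℝ)
    · have hw1 : 0 < 1 - ‖w‖ ^ 2 := sub_pos.2 hw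
      have h0 : 0 < ‖w‖ ^ 2 := by positivity
      rw [indicator_of_mem hw, indicator_of_mem hw, ← ENNReal.ofReal_mul (by positivity),
        ballWeight, Real.rpow_mul (norm_nonneg _), Real.rpow_two, Real.rpow_add hw1,
        Real.rpow_add h0]
      congr 1
      ring
    · rw [indicator_of_notMem hw, indicator_of_notMem hw, zero_mul]
  obtain ⟨κ, hκ, hpol⟩ := exists_lintegral_coord i
  rw [e, hpol 0 _ measurable_radialWeight, lintegral_Ioi_radialWeight] at h1
  have hΓ : 0 < Real.Gamma (n + 0 : ℕ) := Real.Gamma_pos_of_pos (by exact_mod_cast i.pos)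
  have hκ' : ENNReal.ofReal (κ * ((Nat.factorial 0 : ℝ) / Real.Gamma (n + 0 : ℕ))) ≠ 0 := by
    simp only [ne_eq, ENNReal.ofReal_eq_zero, not_le]
    positivity
  have h2 := exponents_of_lintegral_lt_top (ENNReal.lt_top_of_mul_ne_top_right h1.ne hκ')
  refine ⟨h2.2, ?_⟩
  have h3 := h2.1
  rw [add_zero, Nat.cast_sub i.pos] at h3
  push_cast at h3
  linarith

end Integrability

/-! ### Necessity of the exponent conditions -/

section Necessity

variable {n : ℕ} {a b c d p : ℝ}

lemma mu_ne_zero_of_isOpen (i : Fin n) (hc : -1 < c) (hd : -(n : ℝ) < d) {U : Set (Cn n)}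
    (hU : IsOpen U) (hne : U.Nonempty) (hsub : U ⊆ Metric.ball 0 1) : mu n c d U ≠ 0 := by
  have : Nontrivial (Cn n) := by
    have := i.pos
    apply Module.nontrivial_of_finrank_pos (R := ℝ)
    rw [finrank_Cn]
    omega
  have hac : (volume : Measure (Cn n)).restrict (Metric.ball 0 1) ≪ mu n c d := by
    refine withDensity_absolutelyContinuous' (by fun_prop) ?_
    filter_upwards [ae_restrict_mem Metric.isOpen_ball.measurableSet,
      ae_restrict_of_ae (Measure.ae_ne volume (0 : Cn n))] with w hw hw0
    have hw1 := one_sub_norm_sq_pos (by simpa using hw : ‖w‖ < 1)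
    have h0 := norm_pos_iff.2 hw0
    have hM : 0 < ((n - 1).factorial : ℝ) / (Real.pi ^ n * ProbabilityTheory.beta (c + 1) (d + n)) :=
      muConst_pos hc hd
    simp only [ne_eq, ENNReal.ofReal_eq_zero, not_le]
    positivity
  intro h
  have h2 := hac h
  rw [Measure.restrict_apply hU.measurableSet, inter_eq_left.2 hsub] at h2
  exact hU.measure_ne_zero volume hne h2

/-- Since 𝒦(0) = 1 and |⟨z,w⟩| ≤ |z|, continuity at 0 is uniform in w. -/
lemma exists_forall_re_K_ge (ha : -1 < a) (hb : -(n : ℝ) < b) : ∃ δ : ℝ, 0 < δ ∧ δ ≤ 1 ∧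
    ∀ z w : Cn n, ‖z‖ < δ → ‖w‖ < 1 → 1 / 2 ≤ (K n a b (herm z w)).re := by
  have hcont : ContinuousAt (K n a b) 0 :=
    (continuousOn_K ha hb).continuousAt (Metric.isOpen_ball.mem_nhds (by simp))
  obtain ⟨δ, hδ, h⟩ := Metric.continuousAt_iff.1 hcont (1 / 2) (by norm_num)
  refine ⟨min δ 1, lt_min hδ one_pos, min_le_right _ _, fun z w hz hw => ?_⟩
  have h1 : dist (herm z w) 0 < δ := by
    rw [dist_zero_right]
    calc ‖herm z w‖ ≤ ‖z‖ * ‖w‖ := norm_herm_le z w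
      _ ≤ ‖z‖ := mul_le_of_le_one_right (norm_nonneg _) hw.le
      _ < δ := hz.trans_le (min_le_left _ _)
  have h2 := h h1
  rw [K_zero, dist_eq_norm] at h2
  have h3 := (Complex.abs_re_le_norm _).trans_lt h2
  rw [Complex.sub_re, Complex.one_re, abs_lt] at h3
  linarith [h3.1]

/-- Boundedness of `T` makes `∫ g dμ_{a,b}` a bounded functional on nonnegative functions. -/
lemma exists_lintegral_le_of_bounded (i : Fin n) (ha : -1 < a) (hb : -(n : ℝ) < b) (hc : -1 < c)
    (hd : -(n : ℝ) < d) (hp : 0 < p)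
    (hT : IsBoundedOnLp (kerT n a b) (mu n a b) (mu n c d) (ENNReal.ofReal p)) :
    ∃ C : ℝ≥0∞, C ≠ ∞ ∧ ∀ g : Cn n → ℝ, Measurable g → (∀ w, 0 ≤ g w) →
      ∫⁻ w, ENNReal.ofReal (g w) ^ p ∂(mu n c d) < ∞ →
      ∫⁻ w, ENNReal.ofReal (g w) ∂(mu n a b) ≤
        C * (∫⁻ w, ENNReal.ofReal (g w) ^ p ∂(mu n c d)) ^ (1 / p) := by
  have := isFiniteMeasure_mu hc hd i
  have hp0 : ENNReal.ofReal p ≠ 0 := by simpa using hp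
  obtain ⟨C, hC⟩ := hT
  obtain ⟨δ, hδ0, hδ1, hK⟩ := exists_forall_re_K_ge ha hb
  set m := mu n c d (Metric.ball 0 δ) with hm
  have hm0 : m ≠ 0 := mu_ne_zero_of_isOpen i hc hd Metric.isOpen_ball
    ⟨0, by simpa using hδ0⟩ (Metric.ball_subset_ball hδ1)
  have hmt : m ≠ ∞ := measure_ne_top _ _
  have hmp0 : m ^ (1 / p) ≠ 0 := by simp [ENNReal.rpow_eq_zero_iff, hm0, hmt]
  have hmpt : m ^ (1 / p) ≠ ∞ := ENNReal.rpow_ne_top_of_nonneg (by positivity) hmt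
  refine ⟨2 * (m ^ (1 / p))⁻¹ * C, ENNReal.mul_ne_top (ENNReal.mul_ne_top ENNReal.ofNat_ne_top
    (ENNReal.inv_ne_top.2 hmp0)) ENNReal.coe_ne_top, fun g hg hg0 hfin => ?_⟩
  have hnorm : ∀ f : Cn n → ℂ, eLpNorm f (ENNReal.ofReal p) (mu n c d) =
      (∫⁻ x, ‖f x‖ₑ ^ p ∂(mu n c d)) ^ (1 / p) := fun f => by
    rw [eLpNorm_eq_lintegral_rpow_enorm_toReal hp0 ENNReal.ofReal_ne_top,
      ENNReal.toReal_ofReal hp.le]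
  have hge : ∀ w, ‖(g w : ℂ)‖ₑ = ENNReal.ofReal (g w) := fun w => by
    rw [← ofReal_norm, Complex.norm_real, Real.norm_of_nonneg (hg0 w)]
  have hgn : eLpNorm (fun w => (g w : ℂ)) (ENNReal.ofReal p) (mu n c d) =
      (∫⁻ w, ENNReal.ofReal (g w) ^ p ∂(mu n c d)) ^ (1 / p) := by
    rw [hnorm]
    simp only [hge]
  have hmem : MemLp (fun w => (g w : ℂ)) (ENNReal.ofReal p) (mu n c d) := by
    refine ⟨(by fun_prop : Measurable fun w => (g w : ℂ)).aestronglyMeasurable, ?_⟩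
    rw [hgn]
    exact ENNReal.rpow_lt_top_of_nonneg (by positivity) hfin.ne
  obtain ⟨h1, _, h3⟩ := hC _ hmem
  set I := ∫⁻ w, ENNReal.ofReal (g w) ∂(mu n a b) with hI
  set Tg := integralOp (kerT n a b) (mu n a b) (fun w => (g w : ℂ)) with hTg
  -- For z in the δ-ball, |Tg(z)| ≥ Re Tg(z) ≥ I/2. Taking the L^p norm over that ball, of mass m,
  -- bounds I.
  have hpt : ∀ᵐ z ∂(mu n c d), z ∈ Metric.ball (0 : Cn n) δ → 2⁻¹ * I ≤ ‖Tg z‖ₑ := by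
    filter_upwards [h1] with z hz hzδ
    have hzδ' : ‖z‖ < δ := by simpa using hzδ
    have hre : (Tg z).re = ∫ w, g w * (K n a b (herm z w)).re ∂(mu n a b) := by
      have := integral_re (𝕜 := ℂ) hz
      simp only [RCLike.re_eq_complex_re] at this
      rw [hTg, integralOp, ← this]
      exact integral_congr_ae (ae_of_all _ fun w => by simp [kerT])
    have hint : Integrable (fun w => g w * (K n a b (herm z w)).re) (mu n a b) := by
      refine hz.re.congr (ae_of_all _ fun w => ?_)
      simp [kerT]
    have hKw : ∀ᵐ w ∂(mu n a b), 1 / 2 * g w ≤ g w * (K n a b (herm z w)).re := by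
      filter_upwards [ae_mu_norm_lt_one] with w hw
      rw [mul_comm]
      exact mul_le_mul_of_nonneg_left (hK z w hzδ' hw) (hg0 w)
    have hnn : 0 ≤ᵐ[mu n a b] fun w => g w * (K n a b (herm z w)).re := by
      filter_upwards [hKw] with w hw
      exact le_trans (mul_nonneg (by norm_num) (hg0 w)) hw
    calc 2⁻¹ * I = ∫⁻ w, ENNReal.ofReal (1 / 2 * g w) ∂(mu n a b) := by
          rw [hI, ← lintegral_const_mul' _ _ (by simp)]
          refine lintegral_congr fun w => ?_
          rw [ENNReal.ofReal_mul (by norm_num), one_div, ENNReal.ofReal_inv_of_pos two_pos]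
          simp
      _ ≤ ∫⁻ w, ENNReal.ofReal (g w * (K n a b (herm z w)).re) ∂(mu n a b) := by
          refine lintegral_mono_ae ?_
          filter_upwards [hKw] with w hw
          exact ENNReal.ofReal_le_ofReal hw
      _ = ENNReal.ofReal (Tg z).re := by
          rw [hre, ofReal_integral_eq_lintegral_ofReal hint hnn]
      _ ≤ ‖Tg z‖ₑ := by
          rw [← ofReal_norm]
          exact ENNReal.ofReal_le_ofReal (Complex.re_le_norm _)
  have hlow : 2⁻¹ * I * m ^ (1 / p) ≤
      C * (∫⁻ w, ENNReal.ofReal (g w) ^ p ∂(mu n c d)) ^ (1 / p) := by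
    calc 2⁻¹ * I * m ^ (1 / p) = (∫⁻ _ in Metric.ball 0 δ, (2⁻¹ * I) ^ p ∂(mu n c d)) ^ (1 / p) := by
          rw [setLIntegral_const, ENNReal.mul_rpow_of_nonneg _ _ (by positivity),
            ← ENNReal.rpow_mul, mul_one_div_cancel hp.ne', ENNReal.rpow_one]
      _ ≤ (∫⁻ z, ‖Tg z‖ₑ ^ p ∂(mu n c d)) ^ (1 / p) := by
          refine ENNReal.rpow_le_rpow ?_ (by positivity)
          refine le_trans (setLIntegral_mono_ae' Metric.isOpen_ball.measurableSet
            (g := fun z => ‖Tg z‖ₑ ^ p) ?_) (setLIntegral_le_lintegral _ _)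
          filter_upwards [hpt] with z hz hzδ
          gcongr
          exact hz hzδ
      _ ≤ _ := by
          rw [← hnorm, ← hgn]
          exact h3
  calc I = 2 * (m ^ (1 / p))⁻¹ * (2⁻¹ * I * m ^ (1 / p)) := by
        rw [show 2 * (m ^ (1 / p))⁻¹ * (2⁻¹ * I * m ^ (1 / p)) =
          (2 * 2⁻¹) * ((m ^ (1 / p))⁻¹ * m ^ (1 / p)) * I by ring,
          ENNReal.inv_mul_cancel hmp0 hmpt, ENNReal.mul_inv_cancel two_ne_zero ENNReal.ofNat_ne_top,
          one_mul, one_mul]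
    _ ≤ 2 * (m ^ (1 / p))⁻¹ * (C * (∫⁻ w, ENNReal.ofReal (g w) ^ p ∂(mu n c d)) ^ (1 / p)) := by
        gcongr
    _ = _ := by rw [mul_assoc, mul_assoc, mul_assoc]

/-- Dividing by J^{1/p} leaves J^{1/q} ≤ E. Finiteness of J is essential, which is why the test
functions below are truncated. -/
lemma le_rpow_of_le_mul_rpow {p q : ℝ} (hpq : p.HolderConjugate q) {J E : ℝ≥0∞} (hJ : J ≠ ∞)
    (h : J ≤ E * J ^ (1 / p)) : J ≤ E ^ q := by
  by_cases h0 : J = 0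
  · simp [h0]
  have hp := hpq.pos
  have hq := hpq.symm.pos
  have hne : J ^ (1 / p) ≠ 0 := by simp [ENNReal.rpow_eq_zero_iff, h0, hJ]
  have hnt : J ^ (1 / p) ≠ ∞ := ENNReal.rpow_ne_top_of_nonneg (by positivity) hJ
  have hsplit : J = J ^ (1 / q) * J ^ (1 / p) := by
    rw [← ENNReal.rpow_add _ _ h0 hJ, one_div, one_div, add_comm, hpq.inv_add_inv_eq_one,
      ENNReal.rpow_one]
  have h2 : J ^ (1 / q) ≤ E := by
    refine (ENNReal.mul_le_mul_iff_left hne hnt).1 ?_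
    rw [← hsplit]
    exact h
  calc J = (J ^ (1 / q)) ^ q := by
        rw [← ENNReal.rpow_mul, one_div_mul_cancel hq.ne', ENNReal.rpow_one]
    _ ≤ E ^ q := by gcongr

/-- Converse of Hölder: the functional g ↦ ∫ g dμ_{a,b} is bounded on L^p(μ_{c,d}), so its density
lies in L^q. The extremal g is W^{q-1}, truncated, and (q-1)p = q. -/
lemma lintegral_ballWeight_rpow_lt_top (i : Fin n) (ha : -1 < a) (hb : -(n : ℝ) < b)
    (hc : -1 < c) (hd : -(n : ℝ) < d) {q : ℝ} (hpq : p.HolderConjugate q)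
    (hT : IsBoundedOnLp (kerT n a b) (mu n a b) (mu n c d) (ENNReal.ofReal p)) :
    ∫⁻ w, ENNReal.ofReal (ballWeight (q * (a - c)) (q * (b - d)) w) ∂(mu n c d) < ∞ := by
  have := isFiniteMeasure_mu hc hd i
  have hp := hpq.pos
  have hq := hpq.symm.pos
  have hq1 : 0 < q - 1 := sub_pos.2 hpq.symm.lt
  obtain ⟨C, hC, h⟩ := exists_lintegral_le_of_bounded i ha hb hc hd hp hT
  set W : Cn n → ℝ := ballWeight (a - c) (b - d) with hW
  have hWm : Measurable W := measurable_ballWeight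
  set R := ProbabilityTheory.beta (c + 1) (d + n) / ProbabilityTheory.beta (a + 1) (b + n) with hR
  have hR0 : 0 < R := div_pos (ProbabilityTheory.beta_pos (by linarith) (by linarith))
    (ProbabilityTheory.beta_pos (by linarith) (by linarith))
  have hRe : ENNReal.ofReal R ≠ 0 := by simpa using hR0
  -- The cut at N makes the integrals finite. The cut at 0 handles points outside the ball, where a
  -- real power of 1-|w|² < 0 may be negative.
  set M : ℕ → Cn n → ℝ := fun N w => min (max (W w) 0) N with hM
  have hM0 : ∀ N w, 0 ≤ M N w := fun N w => le_min (le_max_right _ _) (Nat.cast_nonneg N)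
  have hMm : ∀ N, Measurable (M N) := fun N => by fun_prop
  have hMp : ∀ N w, ENNReal.ofReal (M N w ^ (q - 1)) ^ p = ENNReal.ofReal (M N w ^ q) := by
    intro N w
    rw [ENNReal.ofReal_rpow_of_nonneg (Real.rpow_nonneg (hM0 N w) _) hp.le,
      ← Real.rpow_mul (hM0 N w), hpq.symm.sub_one_mul_conj]
  have hJfin : ∀ N, ∫⁻ w, ENNReal.ofReal (M N w ^ q) ∂(mu n c d) < ∞ := by
    intro N
    calc _ ≤ ∫⁻ _, ENNReal.ofReal ((N : ℝ) ^ q) ∂(mu n c d) := by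
          refine lintegral_mono fun w => ENNReal.ofReal_le_ofReal ?_
          exact Real.rpow_le_rpow (hM0 N w) (min_le_right _ _) hq.le
      _ < ∞ := by
          rw [lintegral_const]
          exact ENNReal.mul_lt_top ENNReal.ofReal_lt_top (measure_lt_top _ _)
  have hJ : ∀ N, ∫⁻ w, ENNReal.ofReal (M N w ^ q) ∂(mu n c d) ≤
      ((ENNReal.ofReal R)⁻¹ * C) ^ q := by
    intro N
    refine le_rpow_of_le_mul_rpow hpq (hJfin N).ne ?_
    have h1 := h (fun w => M N w ^ (q - 1)) ((hMm N).pow_const _)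
      (fun w => Real.rpow_nonneg (hM0 N w) _) (by simpa only [hMp] using hJfin N)
    simp only [hMp] at h1
    rw [mu_eq_withDensity i ha hb hc hd, lintegral_withDensity_eq_lintegral_mul_non_measurable _
      (by fun_prop) (ae_of_all _ fun w => ENNReal.ofReal_lt_top)] at h1
    have h2 : ENNReal.ofReal R * ∫⁻ w, ENNReal.ofReal (M N w ^ q) ∂(mu n c d) ≤
        C * (∫⁻ w, ENNReal.ofReal (M N w ^ q) ∂(mu n c d)) ^ (1 / p) := by
      refine le_trans ?_ h1
      rw [← lintegral_const_mul' _ _ ENNReal.ofReal_ne_top]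
      refine lintegral_mono_ae ?_
      filter_upwards [ae_mu_norm_lt_one] with w hw
      have hW0 : 0 ≤ W w := ballWeight_nonneg hw
      rw [Pi.mul_apply, ← ENNReal.ofReal_mul hR0.le, ← ENNReal.ofReal_mul (mul_nonneg hR0.le hW0)]
      refine ENNReal.ofReal_le_ofReal ?_
      rw [mul_assoc]
      refine mul_le_mul_of_nonneg_left ?_ hR0.le
      have hMW : M N w ≤ W w := (min_le_left _ _).trans (max_le le_rfl hW0)
      calc M N w ^ q = M N w * M N w ^ (q - 1) := by
            rcases (hM0 N w).eq_or_lt with h0 | h0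
            · rw [← h0, Real.zero_rpow hq.ne', zero_mul]
            · nth_rewrite 2 [← Real.rpow_one (M N w)]
              rw [← Real.rpow_add h0]
              ring_nf
        _ ≤ W w * M N w ^ (q - 1) :=
            mul_le_mul_of_nonneg_right hMW (Real.rpow_nonneg (hM0 N w) _)
    calc ∫⁻ w, ENNReal.ofReal (M N w ^ q) ∂(mu n c d) =
        (ENNReal.ofReal R)⁻¹ * (ENNReal.ofReal R *
          ∫⁻ w, ENNReal.ofReal (M N w ^ q) ∂(mu n c d)) := by
          rw [← mul_assoc, ENNReal.inv_mul_cancel hRe ENNReal.ofReal_ne_top, one_mul]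
      _ ≤ _ := by
          rw [mul_assoc]
          gcongr
  have hmono : Monotone fun (N : ℕ) (w : Cn n) => ENNReal.ofReal (M N w ^ q) := by
    intro N N' hN w
    refine ENNReal.ofReal_le_ofReal (Real.rpow_le_rpow (hM0 N w) ?_ hq.le)
    exact min_le_min_left _ (by exact_mod_cast hN)
  -- The bound is uniform in N, so monotone convergence removes the truncation.
  calc _ ≤ ∫⁻ w, ⨆ N, ENNReal.ofReal (M N w ^ q) ∂(mu n c d) := by
        refine lintegral_mono_ae ?_
        filter_upwards [ae_mu_norm_lt_one] with w hw
        have hW0 : 0 ≤ W w := ballWeight_nonneg hw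
        obtain ⟨N, hN⟩ := exists_nat_ge (W w)
        refine le_trans (le_of_eq ?_) (le_iSup _ N)
        rw [← ballWeight_rpow hw, hM]
        simp only
        rw [max_eq_left hW0, min_eq_left hN]
    _ = ⨆ N, ∫⁻ w, ENNReal.ofReal (M N w ^ q) ∂(mu n c d) :=
        lintegral_iSup (fun N => ((hMm N).pow_const _).ennreal_ofReal) hmono
    _ ≤ ((ENNReal.ofReal R)⁻¹ * C) ^ q := iSup_le hJ
    _ < ∞ := ENNReal.rpow_lt_top_of_nonneg hq.le
        (ENNReal.mul_ne_top (ENNReal.inv_ne_top.2 hRe) hC)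

/-- Multiplying c + q(a-c) > -1 and d + q(b-d) > -n by p - 1, with (p-1)q = p, gives the two
conditions. -/
lemma exponents_of_bounded_of_one_lt (i : Fin n) (ha : -1 < a) (hb : -(n : ℝ) < b) (hc : -1 < c)
    (hd : -(n : ℝ) < d) (hp : 1 < p)
    (hT : IsBoundedOnLp (kerT n a b) (mu n a b) (mu n c d) (ENNReal.ofReal p)) :
    c + 1 < p * (a + 1) ∧ d + n < p * (b + n) := by
  obtain ⟨q, hpq⟩ : ∃ q, p.HolderConjugate q := ⟨_, Real.HolderConjugate.conjExponent hp⟩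
  have h := exponents_of_lintegral_ballWeight_lt_top i hc hd
    (lintegral_ballWeight_rpow_lt_top i ha hb hc hd hpq hT)
  have hp1 : 0 < p - 1 := by linarith
  have hq : (p - 1) * q = p := hpq.sub_one_mul_conj
  have h1 := mul_lt_mul_of_pos_left h.1 hp1
  have h2 := mul_lt_mul_of_pos_left h.2 hp1
  rw [mul_add, ← mul_assoc, hq] at h1 h2
  constructor <;> linarith

/-- Testing `T` on small balls bounds its adjoint kernel in `L¹`. -/
lemma exists_lintegral_norm_K_le (i : Fin n) (ha : -1 < a) (hb : -(n : ℝ) < b) (hc : -1 < c)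
    (hd : -(n : ℝ) < d) {κ : ℝ} (hκ : 0 < κ) (hK : ∀ ξ : ℂ, ‖ξ‖ < 1 → κ ≤ ‖K n a b ξ‖)
    (hT : IsBoundedOnLp (kerT n a b) (mu n a b) (mu n c d) (ENNReal.ofReal 1)) :
    ∃ C : ℝ≥0∞, C ≠ ∞ ∧ ∀ w₀ : Cn n, ‖w₀‖ < 1 → w₀ ≠ 0 →
      ENNReal.ofReal (ballWeight (a - c) (b - d) w₀) *
        ∫⁻ z, ‖K n a b (herm z w₀)‖ₑ ∂(mu n c d) ≤ C := by
  have := isFiniteMeasure_mu hc hd i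
  have := isFiniteMeasure_mu ha hb i
  obtain ⟨C, hC⟩ := hT
  rw [ENNReal.ofReal_one] at hC
  set R := ProbabilityTheory.beta (c + 1) (d + n) / ProbabilityTheory.beta (a + 1) (b + n) with hR
  have hR0 : 0 < R := div_pos (ProbabilityTheory.beta_pos (by linarith) (by linarith))
    (ProbabilityTheory.beta_pos (by linarith) (by linarith))
  -- Of the 4, one factor 2 is lost to the oscillation of the kernel on the test ball, the other to
  -- that of the weight.
  have hRe : ENNReal.ofReal (R / 4) ≠ 0 := by simpa using hR0
  refine ⟨(ENNReal.ofReal (R / 4))⁻¹ * C, ENNReal.mul_ne_top (ENNReal.inv_ne_top.2 hRe)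
    ENNReal.coe_ne_top, fun w₀ hw₀ hne => ?_⟩
  -- Keeping |w| ≤ ρ < 1 makes 𝒦(⟨z,w⟩) uniformly continuous for all |z| ≤ 1, so the test ball can
  -- be chosen independently of z.
  obtain ⟨ρ, hρ0, hρ1⟩ := exists_between hw₀
  have hW0 := ballWeight_pos (x := a - c) (y := b - d) hw₀ hne
  have hcontK : ContinuousOn (fun x : Cn n × Cn n => K n a b (herm x.1 x.2))
      (Metric.closedBall 0 1 ×ˢ Metric.closedBall 0 ρ) := by
    refine (continuousOn_K ha hb).comp continuous_herm.continuousOn ?_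
    rintro ⟨z, w⟩ ⟨hz, hw⟩
    rw [mem_closedBall_zero_iff] at hz hw
    rw [mem_ball_zero_iff]
    calc ‖herm z w‖ ≤ ‖z‖ * ‖w‖ := norm_herm_le z w
      _ ≤ 1 * ρ := by gcongr
      _ < 1 := by rwa [one_mul]
  have huc := ((isCompact_closedBall (0 : Cn n) 1).prod
    (isCompact_closedBall (0 : Cn n) ρ)).uniformContinuousOn_of_continuous hcontK
  obtain ⟨ε₁, hε₁, hu⟩ := Metric.uniformContinuousOn_iff.1 huc (κ / 2) (by positivity)
  have hcontW : ContinuousAt (ballWeight (n := n) (a - c) (b - d)) w₀ := by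
    refine ContinuousAt.mul ?_ ?_
    · exact ContinuousAt.rpow_const (by fun_prop) (Or.inl (one_sub_norm_sq_pos hw₀).ne')
    · exact ContinuousAt.rpow_const (by fun_prop) (Or.inl (norm_pos_iff.2 hne).ne')
  obtain ⟨ε₂, hε₂, hw2⟩ := Metric.eventually_nhds_iff.1
    (hcontW.eventually (lt_mem_nhds (half_lt_self hW0)))
  obtain ⟨ε, hε0, hε⟩ : ∃ ε, 0 < ε ∧ ε ≤ min (min ε₁ ε₂) (ρ - ‖w₀‖) :=
    ⟨_, lt_min (lt_min hε₁ hε₂) (sub_pos.2 hρ0), le_rfl⟩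
  have hε1 : ε ≤ ε₁ := hε.trans ((min_le_left _ _).trans (min_le_left _ _))
  have hε2 : ε ≤ ε₂ := hε.trans ((min_le_left _ _).trans (min_le_right _ _))
  have hε3 : ε ≤ ρ - ‖w₀‖ := hε.trans (min_le_right _ _)
  set U := Metric.ball w₀ ε with hU
  have hUm : MeasurableSet U := Metric.isOpen_ball.measurableSet
  have hUρ : ∀ w ∈ U, ‖w‖ ≤ ρ := by
    intro w hw
    have h1 : ‖w - w₀‖ < ε := by rwa [hU, mem_ball_iff_norm] at hw
    have h2 : ‖w‖ ≤ ‖w - w₀‖ + ‖w₀‖ := by simpa using norm_add_le (w - w₀) w₀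
    linarith
  have hU0 : mu n c d U ≠ 0 := mu_ne_zero_of_isOpen i hc hd Metric.isOpen_ball
    ⟨w₀, by simpa [hU] using hε0⟩ fun w hw => by
      rw [mem_ball_zero_iff]
      exact (hUρ w hw).trans_lt hρ1
  have hUt : mu n c d U ≠ ∞ := measure_ne_top _ _
  set f : Cn n → ℂ := U.indicator fun _ => 1 with hf
  have hfm : MemLp f 1 (mu n c d) := memLp_indicator_const 1 hUm 1 (Or.inr hUt)
  have hfn : eLpNorm f 1 (mu n c d) = mu n c d U := by
    rw [hf, eLpNorm_indicator_const hUm one_ne_zero ENNReal.one_ne_top]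
    simp
  obtain ⟨h1, _, h3⟩ := hC f hfm
  rw [hfn] at h3
  have hpt : ∀ᵐ z ∂(mu n c d), 2⁻¹ * mu n a b U * ‖K n a b (herm z w₀)‖ₑ ≤
      ‖integralOp (kerT n a b) (mu n a b) f z‖ₑ := by
    filter_upwards [h1, ae_mu_norm_lt_one] with z hz hz1
    have hfz : ∀ w, f w * kerT n a b z w = U.indicator (fun w => K n a b (herm z w)) w := by
      intro w
      by_cases hw : w ∈ U
      · rw [hf, indicator_of_mem hw, indicator_of_mem hw, one_mul, kerT]
      · rw [hf, indicator_of_notMem hw, indicator_of_notMem hw, zero_mul]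
    have hTz : integralOp (kerT n a b) (mu n a b) f z = ∫ w in U, K n a b (herm z w) ∂(mu n a b) := by
      rw [integralOp, ← integral_indicator hUm]
      exact integral_congr_ae (ae_of_all _ hfz)
    have hint : IntegrableOn (fun w => K n a b (herm z w)) U (mu n a b) := by
      rw [← integrable_indicator_iff hUm]
      exact hz.congr (ae_of_all _ hfz)
    -- The oscillation is at most κ/2 ≤ |𝒦(⟨z,w₀⟩)|/2, so averaging over U keeps at least half of
    -- |𝒦(⟨z,w₀⟩)|.
    have hdiff : ‖∫ w in U, (K n a b (herm z w) - K n a b (herm z w₀)) ∂(mu n a b)‖ ≤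
        κ / 2 * (mu n a b).real U := by
      refine norm_setIntegral_le_of_norm_le_const (measure_lt_top _ _) fun w hw => ?_
      rw [← dist_eq_norm]
      refine (hu (z, w) ⟨by simpa using hz1.le, by simpa using hUρ w hw⟩ (z, w₀)
        ⟨by simpa using hz1.le, by simpa using hρ0.le⟩ ?_).le
      rw [Prod.dist_eq, dist_self, max_eq_right dist_nonneg]
      exact lt_of_lt_of_le (by simpa [hU] using hw) hε1
    rw [integral_sub hint (integrableOn_const (measure_ne_top _ _)), ← hTz, setIntegral_const] at hdiff
    have hκK := hK _ (norm_herm_lt_one hz1 hw₀)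
    have hnorm : ‖(mu n a b).real U • K n a b (herm z w₀)‖ =
        (mu n a b).real U * ‖K n a b (herm z w₀)‖ := by
      rw [norm_smul, Real.norm_of_nonneg measureReal_nonneg]
    have htri := norm_sub_norm_le ((mu n a b).real U • K n a b (herm z w₀))
      (integralOp (kerT n a b) (mu n a b) f z)
    rw [norm_sub_rev, hnorm] at htri
    have hm0 : 0 ≤ (mu n a b).real U := measureReal_nonneg
    have hreal : 2⁻¹ * (mu n a b).real U * ‖K n a b (herm z w₀)‖ ≤
        ‖integralOp (kerT n a b) (mu n a b) f z‖ := by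
      have := mul_le_mul_of_nonneg_right hκK hm0
      linarith
    rw [← ofReal_norm, ← ofReal_norm]
    refine le_trans (le_of_eq ?_) (ENNReal.ofReal_le_ofReal hreal)
    rw [ENNReal.ofReal_mul (by positivity), ENNReal.ofReal_mul (by positivity),
      ENNReal.ofReal_inv_of_pos two_pos, ofReal_measureReal]
    simp
  have hbig : 2⁻¹ * mu n a b U * ∫⁻ z, ‖K n a b (herm z w₀)‖ₑ ∂(mu n c d) ≤
      C * mu n c d U := by
    rw [← lintegral_const_mul' _ _ (ENNReal.mul_ne_top (by simp) (measure_ne_top _ _))]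
    refine (lintegral_mono_ae hpt).trans ?_
    rw [← eLpNorm_one_eq_lintegral_enorm]
    exact h3
  have hmu : ENNReal.ofReal (R * (ballWeight (a - c) (b - d) w₀ / 2)) * mu n c d U ≤
      mu n a b U := by
    rw [mu_eq_withDensity i ha hb hc hd, withDensity_apply _ hUm, ← setLIntegral_const]
    refine setLIntegral_mono' hUm fun w hw => ENNReal.ofReal_le_ofReal ?_
    refine mul_le_mul_of_nonneg_left (hw2 ?_).le hR0.le
    exact lt_of_lt_of_le (by simpa [hU] using hw) hε2
  set L := ∫⁻ z, ‖K n a b (herm z w₀)‖ₑ ∂(mu n c d) with hL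
  have hfinal : ENNReal.ofReal (R / 4) * (ENNReal.ofReal (ballWeight (a - c) (b - d) w₀) * L) ≤
      C := by
    refine (ENNReal.mul_le_mul_iff_left hU0 hUt).1 ?_
    refine le_trans ?_ hbig
    calc _ = 2⁻¹ * (ENNReal.ofReal (R * (ballWeight (a - c) (b - d) w₀ / 2)) * mu n c d U) * L := by
          have e2 : (2⁻¹ : ℝ≥0∞) = ENNReal.ofReal 2⁻¹ := by
            rw [ENNReal.ofReal_inv_of_pos two_pos]
            simp
          rw [← mul_assoc, ← ENNReal.ofReal_mul (by positivity), e2, ← mul_assoc (ENNReal.ofReal 2⁻¹),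
            ← ENNReal.ofReal_mul (by positivity)]
          have e3 : 2⁻¹ * (R * (ballWeight (a - c) (b - d) w₀ / 2)) =
              R / 4 * ballWeight (a - c) (b - d) w₀ := by ring
          rw [e3]
          ring
      _ ≤ _ := by gcongr
  calc _ = (ENNReal.ofReal (R / 4))⁻¹ * (ENNReal.ofReal (R / 4) *
        (ENNReal.ofReal (ballWeight (a - c) (b - d) w₀) * L)) := by
        rw [← mul_assoc, ENNReal.inv_mul_cancel hRe ENNReal.ofReal_ne_top, one_mul]
    _ ≤ _ := by gcongr

lemma exists_norm_eq (i : Fin n) {r : ℝ} (hr : 0 ≤ r) : ∃ w : Cn n, ‖w‖ = r :=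
  ⟨EuclideanSpace.single i (r : ℂ), by simp [hr]⟩

/-- A negative x would blow up as r → 1, a negative y as r → 0. -/
lemma nonneg_of_forall_rpow_le {x y C : ℝ}
    (h : ∀ r : ℝ, 0 < r → r < 1 → (1 - r ^ 2) ^ x * r ^ (2 * y) ≤ C) : 0 ≤ x ∧ 0 ≤ y := by
  constructor
  · by_contra! hx
    have h1 : Tendsto (fun r : ℝ => 1 - r ^ 2) (𝓝[<] 1) (𝓝[>] 0) := by
      refine tendsto_nhdsWithin_iff.2 ⟨?_, ?_⟩
      · have hc : Continuous fun r : ℝ => 1 - r ^ 2 := by fun_prop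
        have := hc.tendsto 1
        norm_num at this
        exact this.mono_left nhdsWithin_le_nhds
      · filter_upwards [Ioo_mem_nhdsLT (show (0 : ℝ) < 1 by norm_num)] with r hr
        have : r ^ 2 < 1 := pow_lt_one₀ hr.1.le hr.2 two_ne_zero
        exact sub_pos.2 this
    have h2 : Tendsto (fun r : ℝ => (1 - r ^ 2) ^ x) (𝓝[<] 1) atTop :=
      (tendsto_rpow_neg_nhdsGT_zero hx).comp h1
    have h3 : Tendsto (fun r : ℝ => r ^ (2 * y)) (𝓝[<] 1) (𝓝 1) := by
      have := (Real.continuousAt_rpow_const 1 (2 * y) (Or.inl one_ne_zero)).tendsto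
      rw [Real.one_rpow] at this
      exact this.mono_left nhdsWithin_le_nhds
    have h4 := h2.atTop_mul_pos one_pos h3
    obtain ⟨r, hr1, hr2⟩ := ((h4.eventually_gt_atTop C).and
      (Ioo_mem_nhdsLT (show (0 : ℝ) < 1 by norm_num))).exists
    exact absurd (h r hr2.1 hr2.2) (not_le.2 hr1)
  · by_contra! hy
    have h2 : Tendsto (fun r : ℝ => r ^ (2 * y)) (𝓝[>] 0) atTop :=
      tendsto_rpow_neg_nhdsGT_zero (by linarith)
    have h3 : Tendsto (fun r : ℝ => (1 - r ^ 2) ^ x) (𝓝[>] 0) (𝓝 1) := by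
      have hc : ContinuousAt (fun r : ℝ => (1 - r ^ 2) ^ x) 0 :=
        ContinuousAt.rpow_const (by fun_prop) (Or.inl (by norm_num))
      have := hc.tendsto
      norm_num at this
      exact this.mono_left nhdsWithin_le_nhds
    have h4 := h3.pos_mul_atTop one_pos h2
    obtain ⟨r, hr1, hr2⟩ := ((h4.eventually_gt_atTop C).and
      (Ioo_mem_nhdsGT (show (0 : ℝ) < 1 by norm_num))).exists
    exact absurd (h r hr2.1 hr2.2) (not_le.2 hr1)

/-- With |Q| ≥ m and |1-ξ| ≤ 2, the kernel is bounded below, so the L¹ bound on the adjoint kernel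
makes the weight bounded. The stricter c < a comes from the critical Forelli-Rudin integral. -/
lemma exponents_of_bounded_one (i : Fin n) (ha : -1 < a) (hb : -(n : ℝ) < b) (hc : -1 < c)
    (hd : -(n : ℝ) < d) (hQ : ∀ ξ : ℂ, ‖ξ‖ ≤ 1 → Q n a b ξ ≠ 0)
    (hT : IsBoundedOnLp (kerT n a b) (mu n a b) (mu n c d) (ENNReal.ofReal 1)) :
    c < a ∧ d ≤ b := by
  have hn0 : (0 : ℝ) ≤ n := Nat.cast_nonneg n
  obtain ⟨m, hm, hmQ⟩ := exists_le_norm_Q ha hb hQ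
  have hKm : ∀ ξ : ℂ, ‖ξ‖ < 1 → m * ‖1 - ξ‖ ^ (-(a + n + 1)) ≤ ‖K n a b ξ‖ := by
    intro ξ hξ
    rw [norm_K hb hξ, Real.rpow_neg (norm_nonneg _), ← div_eq_mul_inv]
    gcongr
    exact hmQ ξ hξ.le
  have hκ : 0 < m * 2 ^ (-(a + n + 1)) := by positivity
  have hK : ∀ ξ : ℂ, ‖ξ‖ < 1 → m * 2 ^ (-(a + n + 1)) ≤ ‖K n a b ξ‖ := by
    intro ξ hξ
    refine le_trans ?_ (hKm ξ hξ)
    have h1 : ‖1 - ξ‖ ≤ 2 := by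
      have := norm_sub_le (1 : ℂ) ξ
      rw [norm_one] at this
      linarith
    have h0 : 0 < ‖1 - ξ‖ := by
      have := norm_sub_norm_le (1 : ℂ) ξ
      rw [norm_one] at this
      linarith
    refine mul_le_mul_of_nonneg_left ?_ hm.le
    exact Real.rpow_le_rpow_of_nonpos h0 h1 (by linarith)
  obtain ⟨C, hC, h⟩ := exists_lintegral_norm_K_le i ha hb hc hd hκ hK hT
  have := isFiniteMeasure_mu hc hd i
  set v := mu n c d univ with hv
  have hv0 : v ≠ 0 := fun h0 => mu_ne_zero_of_isOpen i hc hd Metric.isOpen_ball ⟨0, by simp⟩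
    (Subset.refl (Metric.ball (0 : Cn n) 1)) (measure_mono_null (subset_univ _) h0)
  have hvt : v ≠ ∞ := measure_ne_top _ _
  set κ := m * 2 ^ (-(a + n + 1)) with hκdef
  have hκv0 : ENNReal.ofReal κ * v ≠ 0 := mul_ne_zero (by simpa using hκ) hv0
  have hκvt : ENNReal.ofReal κ * v ≠ ∞ := ENNReal.mul_ne_top ENNReal.ofReal_ne_top hvt
  have hnn : 0 ≤ a - c ∧ 0 ≤ b - d := by
    refine nonneg_of_forall_rpow_le (C := (C / (ENNReal.ofReal κ * v)).toReal) fun r hr0 hr1 => ?_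
    obtain ⟨w, hw⟩ := exists_norm_eq i hr0.le
    have hw0 : w ≠ 0 := norm_pos_iff.1 (hw ▸ hr0)
    have h1 := h w (hw ▸ hr1) hw0
    rw [ballWeight, hw] at h1
    rw [← ENNReal.ofReal_le_iff_le_toReal (ENNReal.div_ne_top hC hκv0),
      ENNReal.le_div_iff_mul_le (Or.inl hκv0) (Or.inl hκvt)]
    refine le_trans ?_ h1
    gcongr
    rw [hv, ← lintegral_const]
    refine lintegral_mono_ae ?_
    filter_upwards [ae_mu_norm_lt_one] with z hz
    rw [← ofReal_norm]
    exact ENNReal.ofReal_le_ofReal (hK _ (norm_herm_lt_one hz (hw ▸ hr1)))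
  refine ⟨lt_of_le_of_ne (sub_nonneg.1 hnn.1) fun hca => ?_, sub_nonneg.1 hnn.2⟩
  -- If c = a the weight is |w|^{2(b-d)}, at least (1/2)^{2(b-d)} for |w| > 1/2; m is the lower
  -- bound of |Q|. The Forelli-Rudin integral would then stay below C/u near the sphere, while it is
  -- made to exceed C/u + 1.
  set u : ℝ := (1 / 2) ^ (2 * (b - d)) * m with hu
  have hu0 : 0 < u := by positivity
  have hu0' : ENNReal.ofReal u ≠ 0 := by simpa using hu0
  obtain ⟨r, hr1, hr⟩ := exists_le_lintegral_one_sub_herm i hc hd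
    ((C / ENNReal.ofReal u).toReal + 1)
  obtain ⟨s, hs1, hs2⟩ := exists_between (max_lt hr1 (show (1 / 2 : ℝ) < 1 by norm_num))
  have hs0 : 1 / 2 < s := (le_max_right _ _).trans_lt hs1
  obtain ⟨w, hw⟩ := exists_norm_eq i (show 0 ≤ s by linarith)
  have hw0 : w ≠ 0 := norm_pos_iff.1 (by rw [hw]; linarith)
  have hw1 : ‖w‖ < 1 := hw ▸ hs2
  have h1 := hr w (by rw [hw]; exact (le_max_left _ _).trans_lt hs1) hw1
  have h2 := h w hw1 hw0
  have h3 : ENNReal.ofReal u *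
      ∫⁻ z, ENNReal.ofReal (‖1 - herm w z‖ ^ (-(n + 1 + c))) ∂(mu n c d) ≤ C := by
    refine le_trans ?_ h2
    rw [hu, ENNReal.ofReal_mul (by positivity), mul_assoc]
    gcongr
    · rw [ballWeight, hca, sub_self, Real.rpow_zero, one_mul, hw]
      exact Real.rpow_le_rpow (by norm_num) hs0.le (mul_nonneg two_pos.le hnn.2)
    · rw [← lintegral_const_mul' _ _ ENNReal.ofReal_ne_top]
      refine lintegral_mono_ae ?_
      filter_upwards [ae_mu_norm_lt_one] with z hz
      rw [← ENNReal.ofReal_mul hm.le, ← ofReal_norm, norm_one_sub_herm_comm]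
      refine ENNReal.ofReal_le_ofReal (le_trans (le_of_eq ?_) (hKm _ (norm_herm_lt_one hz hw1)))
      rw [hca]
      ring_nf
  have hCu : C / ENNReal.ofReal u ≠ ∞ := ENNReal.div_ne_top hC hu0'
  have h4 : ENNReal.ofReal ((C / ENNReal.ofReal u).toReal + 1) ≤ C / ENNReal.ofReal u := by
    rw [ENNReal.le_div_iff_mul_le (Or.inl hu0') (Or.inl ENNReal.ofReal_ne_top), mul_comm]
    refine le_trans ?_ h3
    gcongr
  rw [ENNReal.ofReal_le_iff_le_toReal hCu] at h4
  linarith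

end Necessity

end BergmanType

end

/-! ### The theorem -/

theorem theorem2p5 (n : ℕ) (hn : 1 ≤ n) (a b c d : ℝ) (ha : -1 < a) (hc : -1 < c)
    (hb : -(n : ℝ) < b) (hd : -(n : ℝ) < d)
    (hQ : ∀ ξ : ℂ, ‖ξ‖ ≤ 1 → BergmanType.Q n a b ξ ≠ 0)
    (p : ℝ) (hp : 1 ≤ p) :
    (∀ (f : BergmanType.Cn n → ℂ) (z : BergmanType.Cn n), ‖z‖ < 1 →
      BergmanType.T n a b f z =
        ((ProbabilityTheory.beta (c + 1) (d + n) / ProbabilityTheory.beta (a + 1) (b + n) : ℝ) : ℂ) *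
          ∫ w, f w * BergmanType.Q n a b (BergmanType.herm z w) /
              (1 - BergmanType.herm z w) ^ ((a + n + 1 : ℝ) : ℂ) *
            (((1 - ‖w‖ ^ 2) ^ (a - c) * ‖w‖ ^ (2 * b - 2 * d) : ℝ) : ℂ)
            ∂(BergmanType.mu n c d)) ∧
    List.TFAE [
      BergmanType.IsBoundedOnLp (BergmanType.kerT n a b) (BergmanType.mu n a b)
        (BergmanType.mu n c d) (ENNReal.ofReal p),
      BergmanType.IsBoundedOnLp (BergmanType.kerS n a b c d) (BergmanType.mu n c d)
        (BergmanType.mu n c d) (ENNReal.ofReal p),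
      c + 1 < p * (a + 1) ∧ (1 < p → d + n < p * (b + n)) ∧ (p = 1 → d ≤ b)] := by
  have i : Fin n := ⟨0, hn⟩
  refine ⟨fun f z hz => BergmanType.T_eq i ha hb hc hd f hz, ?_⟩
  -- T may have cancellation that S lacks, so the cycle returns from T to S through the exponents.
  tfae_have 2 → 1 := BergmanType.kerT_bounded_of_kerS_bounded i ha hb hc hd
  tfae_have 1 → 3 := by
    intro hT
    rcases hp.eq_or_lt with rfl | hp1
    · have h := BergmanType.exponents_of_bounded_one i ha hb hc hd hQ hT
      exact ⟨by linarith [h.1], fun h1 => absurd h1 (lt_irrefl _), fun _ => h.2⟩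
    · have h := BergmanType.exponents_of_bounded_of_one_lt i ha hb hc hd hp1 hT
      exact ⟨h.1, fun _ => h.2, fun h1 => absurd h1 hp1.ne'⟩
  tfae_have 3 → 2 := by
    rintro ⟨h1, h2, h3⟩
    rcases hp.eq_or_lt with rfl | hp1
    · exact BergmanType.kerS_bounded_one i ha hb hc hd (by linarith) (h3 rfl)
    · exact BergmanType.kerS_bounded_of_one_lt i ha hb hc hd hp1 h1 (h2 hp1)
  tfae_finish
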